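/- Conventions. The reals are the Cantor space ${}^\omega 2$ and the plane is ${}^\omega 2\times{}^\omega 2$. For a cardinal $\mu$, a $\mu$-square is a set $A\times A$ with $A\subseteq{}^\omega 2$, $|A|=\mu$; a perfect square is a set $P\times P$ with $P\subseteq{}^\omega 2$ perfect (nonempty, closed, without isolated points). $\otimes_\mu$ is the statement: every Borel subset of the plane that contains a $\mu$-square contains a $2^{\aleph_0}$-square and even a perfect square. MA is Martin's axiom: for every nonempty c.c.c. forcing notion and every family of fewer than $2^{\aleph_0}$ dense subsets there is a filter meeting all of them. Let $M$ be a first-order structure and $B\subseteq M$. Write $a\in \mathrm{cl}(B,M)$ if for some quantifier-free formula $\varphi(y,x_1,\dots,x_n)$ and $b_1,\dots,b_n\in B$ we have $M\models\varphi[a,b_1,\dots,b_n]$ and $\{y\in M: M\models\varphi[y,b_1,\dots,b_n]\}$ is countable. For finite nonempty $w\subseteq M$ define $\mathrm{rk}(w,M)\ge\alpha$ by induction on the ordinal $\alpha$: $\mathrm{rk}(w,M)\ge 0$ iff no $a\in w$ is in $\mathrm{cl}(w\setminus\{a\},M)$; for limit $\delta$, $\mathrm{rk}(w,M)\ge\delta$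 iff $\mathrm{rk}(w,M)\ge\alpha$ for all $\alpha<\delta$; and, for $w=\{a_0,\dots,a_{n-1}\}$ with $n=|w|$, $\mathrm{rk}(w,M)\ge\beta+1$ iff for every $k<n$ and every quantifier-free $\varphi(x_0,\dots,x_{n-1})$ with $M\models\varphi[a_0,\dots,a_{n-1}]$ there are $a^i_m\in M$ ($i<2$, $m<n$) such that $\mathrm{rk}(\{a^i_m: i<2,m<n\},M)\ge\beta$, $M\models\varphi[a^i_0,\dots,a^i_{n-1}]$ for $i<2$, $a^0_k\ne a^1_k$, $a^0_m=a^1_m$ for $m\ne k$, and $a^0_m=a_m$ for all $m$. Let $\mathrm{rk}(w,M)$ be the largest such $\alpha$ ($-1$ if there is none, $\infty$ if all $\alpha$ qualify), and $\mathrm{rk}(M)=\sup\{\mathrm{rk}(w,M)+1: w\subseteq M\text{ finite nonempty}\}$. Let $\lambda_{\omega_1}(\aleph_0)$ be the least cardinal $\lambda$ such that every structure $M$ with universe of cardinality $\lambda$ and countable vocabulary has $\mathrm{rk}(M)\ge\omega_1$. Theorem 1.12. Assume MA. (1) Let $\mu$ be a cardinal, and assume $2^{\aleph_0}\ge\lambda_{\omega_1}(\aleph_0)$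 or $2^{\aleph_0}>\mu$. Then there is a Borel subset of the plane that contains a $\mu$-square but no perfect square if and only if $\mu<\lambda_{\omega_1}(\aleph_0)$. (2) If $2^{\aleph_0}\ge\aleph_\alpha$ for every $\alpha<\omega_1$, then $\otimes_{\aleph_\alpha}$ fails for every $\alpha<\omega_1$. (3) If $\min\{\mu:\otimes_\mu\}<2^{\aleph_0}$, then this minimum has cofinality $\aleph_1$. -/

import Mathlib

open Cardinal Ordinal Set

namespace BorelSquares

/-! ### Martin's axiom -/

/-- Two conditions are compatible if they have a common extension (larger conditions are
stronger). -/
def Compatible {P : Type} [Preorder P] (p q : P) : Prop :=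
  ∃ r, p ≤ r ∧ q ≤ r

/-- The countable chain condition: every set of pairwise incompatible conditions is countable. -/
def CCC (P : Type) [Preorder P] : Prop :=
  ∀ A : Set P, A.Pairwise (fun p q => ¬ Compatible p q) → A.Countable

/-- Martin's axiom `MA`: for every nonempty c.c.c. forcing notion and every family of fewer than
`2 ^ ℵ₀` dense sets, there is a directed, downward closed, nonempty set of conditions (a filter, in
the convention in which larger conditions are stronger) that meets every member of the family. -/
def MartinsAxiom : Prop :=
  ∀ (P : Type) [Preorder P] [Nonempty P], CCC P →
    ∀ D : Set (Set P), #D < 𝔠 → (∀ d ∈ D, IsCofinal d) →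
      ∃ G : Order.Ideal P, ∀ d ∈ D, ((G : Set P) ∩ d).Nonempty

/-! ### Squares in the plane -/

/-- The reals, i.e. the Cantor space of infinite `0`-`1` sequences with the product topology. -/
abbrev Reals : Type := ℕ → Bool

/-- `B` is a Borel subset of the plane. -/
def IsBorel (B : Set (Reals × Reals)) : Prop :=
  @MeasurableSet (Reals × Reals) (borel (Reals × Reals)) B

/-- `B` contains a `μ`-square, i.e. a set `A × A` with `|A| = μ`. -/
def ContainsSquare (B : Set (Reals × Reals)) (μ : Cardinal.{0}) : Prop :=
  ∃ A : Set Reals, #A = μ ∧ A ×ˢ A ⊆ B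

/-- `B` contains a perfect square, i.e. a set `C × C` with `C` nonempty, closed and without
isolated points. -/
def ContainsPerfectSquare (B : Set (Reals × Reals)) : Prop :=
  ∃ C : Set Reals, Perfect C ∧ C.Nonempty ∧ C ×ˢ C ⊆ B

/-- The property `⊗_μ`: every Borel subset of the plane that contains a `μ`-square contains a
`2 ^ ℵ₀`-square and even a perfect square. -/
def Otimes (μ : Cardinal.{0}) : Prop :=
  ∀ B : Set (Reals × Reals), IsBorel B → ContainsSquare B μ →
    ContainsSquare B 𝔠 ∧ ContainsPerfectSquare B

/-! ### The rank of a model -/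

section Rank

variable (L : FirstOrder.Language.{0, 0}) (M : Type) [L.Structure M] (κ : Cardinal.{0})

/-- `cl_{<κ}(B, M)`: the elements `a` that satisfy some quantifier-free formula `φ(y, b₁, …, bₙ)`
with parameters in `B` which has fewer than `κ` solutions `y` in `M`. -/
def cl (B : Set M) : Set M :=
  {a | ∃ (n : ℕ) (φ : L.Formula (Fin (n + 1))) (b : Fin n → M), φ.IsQF ∧ (∀ i, b i ∈ B) ∧
    φ.Realize (Fin.cons a b : Fin (n + 1) → M) ∧
    #{x : M | φ.Realize (Fin.cons x b : Fin (n + 1) → M)} < κ}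

/-- `rk(w, M; <κ) ≥ 0`: `w` is finite and nonempty, and no `a ∈ w` is in `cl_{<κ}(w \ {a}, M)`. -/
def RankGEZero (w : Set M) : Prop :=
  w.Finite ∧ w.Nonempty ∧ ∀ a ∈ w, a ∉ cl L M κ (w \ {a})

/-- The successor step: if `R w` says `rk(w, M; <κ) ≥ β`, then `RankStep L M R w` says
`rk(w, M; <κ) ≥ β + 1`. Here `a` enumerates `w` without repetition, and the two tuples `c 0`, `c 1`
satisfy `φ`, agree except at the `k`-th place, where they differ, and the first one is `a`. -/
def RankStep (R : Set M → Prop) (w : Set M) : Prop :=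
  w.Finite ∧ w.Nonempty ∧
    ∀ (n : ℕ) (a : Fin n → M), Function.Injective a → Set.range a = w →
      ∀ (k : Fin n) (φ : L.Formula (Fin n)), φ.IsQF → φ.Realize a →
        ∃ c : Fin 2 → Fin n → M,
          R {x | ∃ i m, x = c i m} ∧
          (∀ i, φ.Realize (c i)) ∧
          c 0 k ≠ c 1 k ∧ (∀ m, m ≠ k → c 0 m = c 1 m) ∧
          (∀ m, a m = c 0 m)

/-- `rk(w, M; <κ) ≥ α`, by induction on the ordinal `α`. -/
noncomputable def RankGE (α : Ordinal.{0}) : Set M → Prop :=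
  Ordinal.limitRecOn (motive := fun _ => Set M → Prop) α
    (RankGEZero L M κ)
    (fun _ R => RankStep L M R)
    (fun δ _ R w => ∀ (β : Ordinal.{0}) (h : β < δ), R β h w)

/-- `rk(w, M; <κ)`: the largest `α` with `rk(w, M; <κ) ≥ α`, with the value `⊥` (written `-1` on
paper) if there is none and `⊤` (written `∞`) if `rk(w, M; <κ) ≥ α` for all `α`. -/
noncomputable def rank (w : Set M) : WithBot (WithTop Ordinal.{0}) :=
  sSup {x | ∃ α : Ordinal.{0}, x = ((α : WithTop Ordinal.{0}) : WithBot (WithTop Ordinal.{0})) ∧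
    RankGE L M κ α w}

/-- The operation `r ↦ r + 1` on ranks, with `-1 + 1 = 0` and `∞ + 1 = ∞`. -/
noncomputable def addOne : WithBot (WithTop Ordinal.{0}) → WithTop Ordinal.{0} :=
  WithBot.recBotCoe 0 (fun r => r + 1)

/-- `rk(M; <κ)`: the supremum of `rk(w, M; <κ) + 1` over the finite nonempty `w ⊆ M`. -/
noncomputable def modelRank : WithTop Ordinal.{0} :=
  ⨆ w : {w : Set M // w.Finite ∧ w.Nonempty}, addOne (rank L M κ w)

end Rank

/-- `Pr_α(lam; <κ, θ)`: every model of cardinality `lam` whose vocabulary has cardinality at most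
`θ` satisfies `rk(M; <κ) ≥ α`. -/
def RankProperty (α : Ordinal.{0}) (lam κ θ : Cardinal.{0}) : Prop :=
  ∀ (L : FirstOrder.Language.{0, 0}) (M : Type) [L.Structure M],
    L.card ≤ θ → #M = lam → (α : WithTop Ordinal.{0}) ≤ modelRank L M κ

/-- `λ_α(κ)`: the least `lam` with `Pr_α(lam; <κ⁺, κ)`. -/
noncomputable def lambda (α : Ordinal.{0}) (κ : Cardinal.{0}) : Cardinal.{0} :=
  sInf {lam | RankProperty α lam (Order.succ κ) κ}

end BorelSquares

/-! Everything passes through the notion `Thin`, which strips the model-theoretic rank down to a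
countable colouring of tuples: adding a same-coloured twin of a prescribed coordinate lowers an
ordinal attached to the colour. By `mk_lt_lambda_iff`, a cardinal is thin exactly when it is below
`lambda (ω_ 1) ℵ₀`.

Without Martin's axiom, a square inside a Borel set with no perfect square has a thin side
(`thin_of_borel`). The Borel set is a continuous image of Baire space, so each pair has a witness
there. If some finite tuple can be split forever, coordinate by coordinate and together with its
witnesses, a fusion yields a perfect square. Otherwise each tuple is lost at some ordinal stage, and
these stages show thinness.

Conversely, Martin's axiom turns a thin type of size below the continuum into a Borel set
(`exists_borel_of_thin`). A c.c.c. forcing adds reals indexed by the type and closed sets covering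
their pairs. A perfect square in the union would give an endless chain of split tuples, hence
infinitely descending ordinals.

These two facts give (1). For (2), every `ℵ_ α` with `α < ω_ 1` is thin (`thin_of_mk_le_aleph`). For
(3), the minimum is the least non-thin cardinal, and `cof_eq_aleph_one_of_least` computes its
cofinality. -/

namespace BorelSquares

/-! ### Thin types and their closure properties. -/

/-- A combinatorial form of `rk(M) < ω₁` for some model on `M`: tuples are coloured by `D`, the
colour determines a coordinate `k` and an ordinal `β < θ`, and adding a twin of the `k`-th
coordinate, i.e. one that can replace it without changing the colour, lowers the ordinal. -/
def ThinBelow (M : Type) (θ : Ordinal.{0}) : Prop :=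
  ∃ (D : ∀ r : ℕ, (Fin (r + 1) → M) → ℕ) (k : ∀ r : ℕ, ℕ → Fin (r + 1)) (β : ℕ → Ordinal.{0}),
    (∀ d, β d < θ) ∧ ∀ (r : ℕ) (a : Fin (r + 1) → M) (b : M), Function.Injective a →
      b ∉ Set.range a → D r (Function.update a (k r (D r a)) b) = D r a →
      β (D (r + 1) (Fin.snoc a b)) < β (D r a)

/-- `M` is `ThinBelow` some ordinal. -/
def Thin (M : Type) : Prop := ∃ θ, ThinBelow M θ

theorem ThinBelow.of_countable {M : Type} {C : Type*} [Countable C] [Nonempty C] {θ : Ordinal.{0}}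
    (D : ∀ r : ℕ, (Fin (r + 1) → M) → C) (k : ∀ r : ℕ, C → Fin (r + 1)) (β : C → Ordinal.{0})
    (hβ : ∀ c, β c < θ)
    (h : ∀ (r : ℕ) (a : Fin (r + 1) → M) (b : M), Function.Injective a →
      b ∉ Set.range a → D r (Function.update a (k r (D r a)) b) = D r a →
      β (D (r + 1) (Fin.snoc a b)) < β (D r a)) : ThinBelow M θ := by
  obtain ⟨e, he⟩ := exists_injective_nat C
  have hl : ∀ c, Function.invFun e (e c) = c := Function.leftInverse_invFun he
  refine ⟨fun r a => e (D r a), fun r n => k r (Function.invFun e n),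
    fun n => β (Function.invFun e n), fun _ => hβ _, fun r a b ha hb hD => ?_⟩
  simp only [hl] at hD ⊢
  exact h r a b ha hb (he hD)

theorem countable_Iio_of_lt_omega_one {θ : Ordinal.{0}} (hθ : θ < ω_ 1) :
    Countable (Set.Iio θ) := by
  rw [← Cardinal.mk_le_aleph0_iff, Cardinal.mk_Iio_ordinal, ← Cardinal.lift_aleph0.{1, 0},
    Cardinal.lift_le]
  have h : θ.card < ℵ_ 1 := by
    rwa [← Cardinal.lt_ord, Cardinal.ord_aleph]
  rwa [← Order.lt_succ_iff, Cardinal.succ_aleph0]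

/-- Coordinate and ordinal may depend on the tuple itself: as `θ` is countable, both take countably
many values and can be stored in the colour. -/
theorem ThinBelow.of_tuple {M : Type} {C : Type*} [Countable C] {θ : Ordinal.{0}}
    (hθ : θ < ω_ 1) (D : ∀ r : ℕ, (Fin (r + 1) → M) → C)
    (k : ∀ r : ℕ, (Fin (r + 1) → M) → Fin (r + 1)) (ρ : ∀ r : ℕ, (Fin (r + 1) → M) → Ordinal.{0})
    (hρ : ∀ r a, ρ r a < θ) (hθ0 : 0 < θ)
    (h : ∀ (r : ℕ) (a : Fin (r + 1) → M) (b : M), Function.Injective a →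
      b ∉ Set.range a → D r (Function.update a (k r a) b) = D r a →
      k r (Function.update a (k r a) b) = k r a → ρ r (Function.update a (k r a) b) = ρ r a →
      ρ (r + 1) (Fin.snoc a b) < ρ r a) : ThinBelow M θ := by
  have := countable_Iio_of_lt_omega_one hθ
  rcases isEmpty_or_nonempty M with hM | ⟨⟨x⟩⟩
  · exact ⟨fun _ _ => 0, fun _ _ => 0, fun _ => 0, fun _ => hθ0, fun _ a => (hM.false (a 0)).elim⟩
  have : Nonempty C := ⟨D 0 fun _ => x⟩
  have : Nonempty (Set.Iio θ) := ⟨⟨0, hθ0⟩⟩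
  refine ThinBelow.of_countable (C := C × ℕ × Set.Iio θ)
    (fun r a => (D r a, k r a, ⟨ρ r a, hρ r a⟩)) (fun r c => Fin.ofNat (r + 1) c.2.1)
    (fun c => c.2.2) (fun c => c.2.2.2) fun r a b ha hb hD => ?_
  simp only [Fin.ofNat_eq_cast, Fin.cast_val_eq_self, Prod.mk.injEq] at hD ⊢
  exact h r a b ha hb hD.1 (Fin.ext hD.2.1) (congrArg Subtype.val hD.2.2)

theorem ThinBelow.mono {M : Type} {θ θ' : Ordinal.{0}} (h : ThinBelow M θ) (hθ : θ ≤ θ') :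
    ThinBelow M θ' := by
  obtain ⟨D, k, β, hβ, H⟩ := h
  exact ⟨D, k, β, fun d => (hβ d).trans_le hθ, H⟩

theorem ThinBelow.of_injective {M N : Type} {θ : Ordinal.{0}} (h : ThinBelow N θ) (f : M → N)
    (hf : Function.Injective f) : ThinBelow M θ := by
  obtain ⟨D, k, β, hβ, H⟩ := h
  refine ⟨fun r a => D r (f ∘ a), k, β, hβ, fun r a b ha hb hD => ?_⟩
  simp only [Function.comp_update] at hD
  simp only [Fin.comp_snoc]
  refine H r (f ∘ a) (f b) (hf.comp ha) ?_ hD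
  rintro ⟨i, hi⟩
  exact hb ⟨i, hf hi⟩

theorem ThinBelow.of_mk_le {M N : Type} {θ : Ordinal.{0}} (h : ThinBelow N θ) (hMN : #M ≤ #N) :
    ThinBelow M θ := by
  obtain ⟨f⟩ := hMN
  exact h.of_injective f f.injective

/-- The tuple serves as its own colour, so no twins exist and the condition is vacuous. -/
theorem ThinBelow.of_countable_type {M : Type} [Countable M] : ThinBelow M 1 := by
  rcases isEmpty_or_nonempty M with hM | hM
  · exact ⟨fun _ _ => 0, fun _ _ => 0, fun _ => 0, fun _ => zero_lt_one,
      fun _ a => (hM.false (a 0)).elim⟩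
  refine ThinBelow.of_countable (C := Σ r : ℕ, (Fin (r + 1) → M)) (fun r a => ⟨r, a⟩)
    (fun _ _ => 0) (fun _ => 0) (fun _ => zero_lt_one) fun r a b _ hb hD => ?_
  simp only [Sigma.mk.injEq, heq_eq_eq, true_and] at hD
  refine (hb ⟨0, ?_⟩).elim
  rw [← hD, Function.update_self]

theorem rank_lt_omega_one (R : ℕ → ℕ → Prop) [hR : IsWellFounded ℕ R] (n : ℕ) :
    IsWellFounded.rank R n < ω_ 1 := by
  induction n using hR.wf.induction with
  | _ n ih =>
    rw [IsWellFounded.rank_eq]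
    exact Ordinal.iSup_lt_omega_one fun b =>
      (Cardinal.isSuccLimit_omega 1).succ_lt (ih b.1 b.2)

/-- The ordinals of a thin type can be taken below a fixed countable ordinal. -/
theorem Thin.exists_lt {M : Type} (h : Thin M) : ∃ θ < ω_ 1, ThinBelow M θ := by
  obtain ⟨_, D, k, β, -, H⟩ := h
  -- Only the order of the values `β n` matters, so they may be replaced by ranks of a well-founded
  -- relation on `ℕ`, which are countable.
  let R : ℕ → ℕ → Prop := fun m n => β m < β n
  have hR : IsWellFounded ℕ R := ⟨InvImage.wf β wellFounded_lt⟩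
  refine ⟨⨆ n, Order.succ (IsWellFounded.rank R n), Ordinal.iSup_lt_omega_one fun n =>
      (Cardinal.isSuccLimit_omega 1).succ_lt (rank_lt_omega_one R n), D, k,
    fun n => IsWellFounded.rank R n, fun n => ?_, fun r a b ha hb hD =>
      IsWellFounded.rank_lt_of_rel (H r a b ha hb hD)⟩
  exact (Order.lt_succ _).trans_le
    (Ordinal.le_iSup (fun n => Order.succ (IsWellFounded.rank R n)) n)

theorem Thin.of_mk_le {M N : Type} (h : Thin N) (hMN : #M ≤ #N) : Thin M :=
  h.imp fun _ h => h.of_mk_le hMN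

/-- A subtype version of `ThinBelow` with the colouring defined on tuples of the ambient type. -/
theorem ThinBelow.extend {M : Type} {s : Set M} {θ : Ordinal.{0}} (h : ThinBelow s θ) :
    ∃ (D : ∀ r : ℕ, (Fin (r + 1) → M) → ℕ) (k : ∀ r : ℕ, ℕ → Fin (r + 1)) (β : ℕ → Ordinal.{0}),
    (∀ d, β d < θ) ∧ ∀ (r : ℕ) (a : Fin (r + 1) → M) (b : M), Function.Injective a →
      (∀ i, a i ∈ s) → b ∈ s →
      b ∉ Set.range a → D r (Function.update a (k r (D r a)) b) = D r a →
      β (D (r + 1) (Fin.snoc a b)) < β (D r a) := by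
  obtain ⟨D, k, β, hβ, H⟩ := h
  rcases s.eq_empty_or_nonempty with hs | hs
  · exact ⟨fun _ _ => 0, k, β, hβ, fun r a b _ _ hb => by simp [hs] at hb⟩
  have : Nonempty s := hs.to_subtype
  let f : M → s := Function.invFun Subtype.val
  have hf : ∀ x : s, f x = x := Function.leftInverse_invFun Subtype.val_injective
  refine ⟨fun r a => D r (f ∘ a), k, β, hβ, fun r a b ha has hbs hb hD => ?_⟩
  have e : f ∘ a = fun i => (⟨a i, has i⟩ : s) := by
    funext i; exact hf ⟨a i, has i⟩
  simp only [Function.comp_update] at hD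
  simp only [Fin.comp_snoc]
  refine H r (f ∘ a) (f b) ?_ ?_ hD
  · rw [e]; intro i j hij; exact ha (congrArg Subtype.val hij)
  · rintro ⟨i, hi⟩
    rw [e, hf ⟨b, hbs⟩] at hi
    exact hb ⟨i, congrArg Subtype.val hi⟩

/-! ### Stepping up along a linear order: the alephs and the cofinality. -/

/-- An index at which a tuple takes its greatest value. -/
noncomputable def topIndex {M : Type} [LinearOrder M] {r : ℕ} (a : Fin (r + 1) → M) :
    Fin (r + 1) := (Finite.exists_max a).choose

theorem le_topIndex {M : Type} [LinearOrder M] {r : ℕ} (a : Fin (r + 1) → M) (i : Fin (r + 1)) :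
    a i ≤ a (topIndex a) := (Finite.exists_max a).choose_spec i

theorem topIndex_eq {M : Type} [LinearOrder M] {r : ℕ} {a : Fin (r + 1) → M}
    (ha : Function.Injective a) {i : Fin (r + 1)} (hi : ∀ j, a j ≤ a i) : topIndex a = i :=
  ha (le_antisymm (hi _) (le_topIndex a i))

-- Remove the greatest entry `c` of a tuple, colour the rest by the colouring of `Set.Iio c`, and
-- record the position of `c`. A twin that preserves this position lies below `c`, so the ordinal
-- drops inside `Set.Iio c`. One-element tuples receive the new top value `θ`.
open Classical in
theorem ThinBelow.succ {M : Type} [LinearOrder M] {θ : Ordinal.{0}} (hθ : θ < ω_ 1)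
    (h : ∀ c : M, ThinBelow (Set.Iio c) θ) : ThinBelow M (Order.succ θ) := by
  choose D k β hβ H using fun c => (h c).extend
  refine ThinBelow.of_tuple (C := ℕ × ℕ) ((Cardinal.isSuccLimit_omega 1).succ_lt hθ)
    (fun r => match r with
      | 0 => fun _ => (0, 0)
      | r + 1 => fun a =>
        (topIndex a, D (a (topIndex a)) r fun i => a ((topIndex a).succAbove i)))
    (fun r => match r with
      | 0 => fun _ => 0
      | r + 1 => fun a => (topIndex a).succAbove (k (a (topIndex a)) r
        (D (a (topIndex a)) r fun i => a ((topIndex a).succAbove i))))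
    (fun r => match r with
      | 0 => fun _ => θ
      | r + 1 => fun a => β (a (topIndex a))
        (D (a (topIndex a)) r fun i => a ((topIndex a).succAbove i)))
    ?_ (Order.bot_lt_succ θ) ?_
  · rintro (_ | r) a
    · exact Order.lt_succ θ
    · exact (hβ _ _).trans (Order.lt_succ θ)
  rintro (_ | r) a b ha hb hD hk -
  · exact hβ _ _
  simp only [Prod.mk.injEq] at hD hk ⊢
  set m := topIndex a with hm
  set j := k (a m) r (D (a m) r fun i => a (m.succAbove i)) with hj
  have hmt : topIndex (Function.update a (m.succAbove j) b) = m := Fin.ext hD.1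
  have hum : Function.update a (m.succAbove j) b m = a m :=
    Function.update_of_ne (Fin.succAbove_ne m j).symm _ _
  have hbm : b < a m := by
    refine lt_of_le_of_ne ?_ fun hc => hb ⟨m, hc.symm⟩
    have := le_topIndex (Function.update a (m.succAbove j) b) (m.succAbove j)
    rwa [hmt, hum, Function.update_self] at this
  have hinj : Function.Injective (Fin.snoc a b : Fin (r + 1 + 1 + 1) → M) :=
    Fin.snoc_injective_iff.2 ⟨ha, hb⟩
  have htop : topIndex (Fin.snoc a b : Fin (r + 1 + 1 + 1) → M) = m.castSucc := by
    refine topIndex_eq hinj fun i => ?_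
    refine Fin.lastCases ?_ (fun i => ?_) i
    · simpa using hbm.le
    · simpa using le_topIndex a i
  have hrest : (fun i => (Fin.snoc a b : Fin (r + 1 + 1 + 1) → M) (m.castSucc.succAbove i)) =
      (Fin.snoc (fun i => a (m.succAbove i)) b : Fin (r + 1 + 1) → M) := by
    funext i
    refine Fin.lastCases ?_ (fun i => ?_) i
    · rw [Fin.succAbove_castSucc_of_le _ _ (Fin.le_last m), Fin.succ_last]
      simp
    · rw [Fin.castSucc_succAbove_castSucc]
      simp
  rw [htop, hrest]
  simp only [Fin.snoc_castSucc]
  refine H (a m) r _ b ?_ ?_ hbm ?_ ?_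
  · exact ha.comp Fin.succAbove_right_injective
  · intro i
    exact lt_of_le_of_ne (le_topIndex a _) fun hc => Fin.succAbove_ne m i (ha hc)
  · rintro ⟨i, hi⟩
    exact hb ⟨_, hi⟩
  · have h2 := hD.2
    rw [hmt, hum] at h2
    have h3 : (fun i => Function.update a (m.succAbove j) b (m.succAbove i)) =
        Function.update (fun i => a (m.succAbove i)) j b :=
      Function.update_comp_eq_of_injective a Fin.succAbove_right_injective j b
    rw [h3] at h2
    exact h2

theorem mk_Iio_ord_toType_lt {μ : Cardinal.{0}} (c : μ.ord.ToType) : #(Set.Iio c) < μ := by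
  have h := Cardinal.mk_Iio_lt c (by rw [Cardinal.mk_ord_toType, Ordinal.type_toType])
  rwa [Cardinal.mk_ord_toType] at h

/-- In the order type of the initial ordinal of `#M`, all proper initial segments have smaller
cardinality. -/
theorem ThinBelow.succ_of_forall_lt {M : Type} {θ : Ordinal.{0}} (hθ : θ < ω_ 1)
    (h : ∀ N : Type, #N < #M → ThinBelow N θ) : ThinBelow M (Order.succ θ) := by
  have h1 : ThinBelow (#M).ord.ToType (Order.succ θ) :=
    ThinBelow.succ hθ fun c => h _ (mk_Iio_ord_toType_lt c)
  exact h1.of_mk_le (Cardinal.mk_ord_toType _).ge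

/-- Only countably many infinite cardinals lie below `ℵ_ α`, so their countable bounds have a
countable supremum, and one more step suffices. -/
theorem thin_of_mk_le_aleph {α : Ordinal.{0}} (hα : α < ω_ 1) :
    ∀ M : Type, #M ≤ ℵ_ α → Thin M := by
  induction α using WellFoundedLT.induction with
  | _ α ih =>
    intro M hM
    have := countable_Iio_of_lt_omega_one hα
    have key : ∀ β : Set.Iio α, ∃ θ < ω_ 1, ∀ N : Type, #N ≤ ℵ_ β.1 → ThinBelow N θ := by
      intro β
      obtain ⟨θ, hθ, h⟩ := (ih β.1 β.2 (lt_trans (show β.1 < α from β.2) hα) (ℵ_ β.1).out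
        (Cardinal.mk_out _).le).exists_lt
      exact ⟨θ, hθ, fun N hN => h.of_mk_le (hN.trans (Cardinal.mk_out _).ge)⟩
    choose θ hθ hN using key
    have hpos : (1 : Ordinal.{0}) < ω_ 1 :=
      Ordinal.one_lt_omega0.trans_le (Ordinal.omega0_le_omega 1)
    have hsup : max 1 (⨆ β, θ β) < ω_ 1 := max_lt hpos (Ordinal.iSup_lt_omega_one hθ)
    refine ⟨_, ThinBelow.succ_of_forall_lt hsup fun N hNM => ?_⟩
    rcases le_or_gt (#N) ℵ₀ with hc | hc
    · have : Countable N := Cardinal.mk_le_aleph0_iff.1 hc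
      exact ThinBelow.of_countable_type.mono (le_max_left _ _)
    · obtain ⟨β, hβ⟩ := Cardinal.mem_range_aleph_iff.2 hc.le
      have hβα : β < α := Cardinal.aleph_lt_aleph.1 (hβ.trans_lt (hNM.trans_le hM))
      exact (hN ⟨β, hβα⟩ N hβ.ge).mono ((Ordinal.le_iSup θ ⟨β, hβα⟩).trans (le_max_right _ _))

/-- The least cardinal that is not thin has cofinality `ℵ₁`. -/
theorem cof_eq_aleph_one_of_least {M : Type} (hM : ¬ Thin M)
    (h : ∀ N : Type, #N < #M → Thin N) : (#M).ord.cof = ℵ_ 1 := by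
  set X := (#M).ord.ToType with hX
  have hT : ∀ c : X, ∃ θ < ω_ 1, ThinBelow (Set.Iio c) θ := fun c =>
    (h _ (mk_Iio_ord_toType_lt c)).exists_lt
  -- `f` is monotone into `ω_ 1`, and unbounded, since a bound would make `X` thin by
  -- `ThinBelow.succ`. Points where `f` exceeds each `θ < ω_ 1` are therefore cofinal, whereas on a
  -- countable set `f` is bounded.
  let f : X → Ordinal.{0} := fun c => sInf {θ | ThinBelow (Set.Iio c) θ}
  have hf : ∀ c, ThinBelow (Set.Iio c) (f c) := fun c =>
    csInf_mem (s := {θ | ThinBelow (Set.Iio c) θ}) ((hT c).imp fun _ h => h.2)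
  have hlt : ∀ c, f c < ω_ 1 := fun c => by
    obtain ⟨θ, hθ, hc⟩ := hT c
    exact (csInf_le' (s := {θ | ThinBelow (Set.Iio c) θ}) hc).trans_lt hθ
  have hmono : ∀ c d, c ≤ d → f c ≤ f d := fun c d hcd =>
    csInf_le' (s := {θ | ThinBelow (Set.Iio c) θ})
      ((hf d).of_injective (Set.inclusion (Set.Iio_subset_Iio hcd)) (Set.inclusion_injective _))
  have hunb : ∀ θ < ω_ 1, ∃ c, θ < f c := by
    intro θ hθ
    by_contra! hc
    have h1 : ThinBelow X (Order.succ θ) := ThinBelow.succ hθ fun c => (hf c).mono (hc c)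
    exact hM ⟨_, h1.of_mk_le (Cardinal.mk_ord_toType _).ge⟩
  rw [← Ordinal.cof_toType]
  apply le_antisymm
  · choose g hg using hunb
    let e : (ω_ 1).ToType → X := fun i =>
      g (Ordinal.ToType.mk.symm i).1 (Ordinal.ToType.mk.symm i).2
    have hcof : IsCofinal (Set.range e) := by
      intro x
      refine ⟨_, ⟨Ordinal.ToType.mk ⟨f x, hlt x⟩, rfl⟩, ?_⟩
      by_contra! hc
      have h1 := hmono _ _ hc.le
      have h2 := hg (f x) (hlt x)
      simp only [e, OrderIso.symm_apply_apply] at h1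
      exact absurd h1 (not_le.2 h2)
    refine (Order.cof_le hcof).trans (Cardinal.mk_range_le.trans ?_)
    rw [Cardinal.mk_toType, Ordinal.card_omega]
  · rw [Order.le_cof_iff]
    intro s hs
    by_contra! hc
    have : Countable s := by
      rw [← Cardinal.mk_le_aleph0_iff, ← Order.lt_succ_iff, Cardinal.succ_aleph0]
      exact hc
    obtain ⟨c, hc⟩ := hunb (⨆ d : s, f d) (Ordinal.iSup_lt_omega_one fun d => hlt d)
    obtain ⟨d, hd, hcd⟩ := hs c
    exact absurd hc (not_lt.2 ((hmono _ _ hcd).trans (Ordinal.le_iSup (fun d : s => f d) ⟨d, hd⟩)))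

/-! ### Partition calculus and the existence of a type that is not thin. -/

open Classical in
/-- The ramification argument behind the Erdős–Rado theorem: in a large set there is a sequence
along which the colour of a finite set does not depend on its last element. -/
theorem exists_endHomogeneous {I C M : Type} [LinearOrder I] [WellFoundedLT I]
    (f : Finset M → C) (h : #(I × ∀ i : I, Finset (Set.Iio i) → C) < #M) :
    ∃ (b : I → M) (a : M), Function.Injective b ∧ ∀ (i : I) (s : Finset I), (∀ j ∈ s, j < i) →
      f (insert (b i) (s.image b)) = f (insert a (s.image b)) := by
  have hne : Nonempty M := by
    rw [← Cardinal.mk_ne_zero_iff]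
    exact (zero_le.trans_lt h).ne'
  -- `c` is new and looks like `a` over the part of the sequence already built.
  let P : ∀ (a : M) (i : I), (Set.Iio i → M) → M → Prop := fun a i b c =>
    (∀ j, c ≠ b j) ∧ ∀ s : Finset (Set.Iio i),
      f (insert c (s.image b)) = f (insert a (s.image b))
  have hb : ∃ b : M → I → M, ∀ a i, b a i = Classical.epsilon (P a i fun j => b a j) := by
    refine ⟨fun a => (wellFounded_lt (α := I)).fix fun i b =>
      Classical.epsilon (P a i fun j => b j.1 j.2), fun a i => ?_⟩
    exact WellFounded.fix_eq _ _ _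
  obtain ⟨b, hb⟩ := hb
  -- The colours that `a` sees along its own sequence determine that sequence. If each `a` occurred
  -- in its sequence, then its index and `τ a` would determine `a`, against the size of `M`. An `a`
  -- outside its sequence witnesses `P` at every stage.
  let τ : M → ∀ i : I, Finset (Set.Iio i) → C := fun a i s =>
    f (insert a (s.image fun j : Set.Iio i => b a j))
  have hτ : ∀ a a', τ a = τ a' → b a = b a' := by
    intro a a' haa
    funext i
    induction i using WellFoundedLT.induction with
    | _ i ih =>
      have e : (fun j : Set.Iio i => b a j) = fun j : Set.Iio i => b a' j :=
        funext fun j => ih j.1 j.2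
      rw [hb a, hb a', e]
      congr 1
      funext c
      have h1 : ∀ s : Finset (Set.Iio i), f (insert a (s.image fun j : Set.Iio i => b a' j)) =
          f (insert a' (s.image fun j : Set.Iio i => b a' j)) := fun s => by
        have := congrFun (congrFun haa i) s
        simp only [τ] at this
        rwa [e] at this
      simp only [P, h1]
  obtain ⟨a, ha⟩ : ∃ a, ∀ i, b a i ≠ a := by
    by_contra! hc
    choose g hg using hc
    refine h.not_ge (Cardinal.mk_le_of_injective (f := fun a => (g a, τ a)) fun a a' haa => ?_)
    rw [Prod.mk.injEq] at haa
    rw [← hg a, ← hg a', haa.1, hτ a a' haa.2]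
  have hP : ∀ i, P a i (fun j => b a j) (b a i) := fun i => by
    rw [hb a i]
    exact Classical.epsilon_spec (p := P a i fun j => b a j)
      ⟨a, fun j => (ha j).symm, fun _ => rfl⟩
  refine ⟨b a, a, ?_, fun i s hs => ?_⟩
  · intro i j hij
    rcases lt_trichotomy i j with hlt | heq | hlt
    · exact ((hP j).1 ⟨i, hlt⟩ hij.symm).elim
    · exact heq
    · exact ((hP i).1 ⟨j, hlt⟩ hij).elim
  · have h1 := (hP i).2 (s.subtype (· ∈ Set.Iio i))
    have h2 : ((s.subtype (· ∈ Set.Iio i)).image fun j : Set.Iio i => b a j) = s.image (b a) := by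
      ext x
      simp only [Finset.mem_image, Finset.mem_subtype, Subtype.exists]
      constructor
      · rintro ⟨j, _, hj, rfl⟩
        exact ⟨j, hj, rfl⟩
      · rintro ⟨j, hj, rfl⟩
        exact ⟨j, hs j hj, hj, rfl⟩
    rwa [h2] at h1

/-- A weak form of the Erdős–Rado theorem. -/
theorem erdos_rado (n : ℕ) (C : Type) (κ : Cardinal.{0}) :
    ∃ lam : Cardinal.{0}, ∀ (M : Type) (f : Finset M → C), lam ≤ #M →
      ∃ H : Set M, κ ≤ #H ∧ ∀ s t : Finset M, (s : Set M) ⊆ H → (t : Set M) ⊆ H →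
        s.card = n → t.card = n → f s = f t := by
  classical
  induction n with
  | zero =>
    refine ⟨κ, fun M f hM => ⟨Set.univ, by simpa using hM, fun s t _ _ hs ht => ?_⟩⟩
    rw [Finset.card_eq_zero.1 hs, Finset.card_eq_zero.1 ht]
  | succ n ih =>
    obtain ⟨lam, hlam⟩ := ih
    refine ⟨Order.succ #(lam.ord.ToType × ∀ i : lam.ord.ToType, Finset (Set.Iio i) → C),
      fun M f hM => ?_⟩
    obtain ⟨b, a, hbi, hb⟩ := exists_endHomogeneous f (Order.succ_le_iff.1 hM)
    -- The last element of a subset of the sequence may be exchanged for `a`, so only a colouring of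
    -- `n`-element sets remains.
    obtain ⟨H, hκ, hH⟩ := hlam _ (fun s => f (insert a (s.image b)))
      (Cardinal.mk_ord_toType lam).ge
    have key : ∀ s : Finset M, (s : Set M) ⊆ b '' H → s.card = n + 1 →
        ∃ t : Finset lam.ord.ToType, (t : Set lam.ord.ToType) ⊆ H ∧ t.card = n ∧
          f s = f (insert a (t.image b)) := by
      intro s hs hcard
      obtain ⟨t, htH, rfl⟩ := Finset.subset_set_image_iff.1 hs
      rw [Finset.card_image_of_injective _ hbi] at hcard
      have htn : t.Nonempty := Finset.card_pos.1 (by omega)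
      have hm := t.max'_mem htn
      refine ⟨t.erase (t.max' htn), ?_, ?_, ?_⟩
      · exact (Finset.coe_subset.2 (Finset.erase_subset _ _)).trans htH
      · rw [Finset.card_erase_of_mem hm]; omega
      · rw [← hb (t.max' htn) _ fun j hj => ?_, ← Finset.image_insert, Finset.insert_erase hm]
        exact lt_of_le_of_ne (t.le_max' _ (Finset.mem_of_mem_erase hj)) (Finset.ne_of_mem_erase hj)
    refine ⟨b '' H, ?_, fun s t hs ht hsn htn => ?_⟩
    · rwa [Cardinal.mk_image_eq hbi]
    · obtain ⟨s', hs', hsc, es⟩ := key s hs hsn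
      obtain ⟨t', ht', htc, et⟩ := key t ht htn
      rw [es, et]
      exact hH s' t' hs' ht' hsc htc

theorem exists_homogeneous (n : ℕ) (C : Type) (κ : Cardinal.{0}) :
    ∃ lam : Cardinal.{0}, ∀ (M : Type) [LinearOrder M] (f : (Fin n → M) → C) (S : Set M),
      lam ≤ #S → ∃ H ⊆ S, κ ≤ #H ∧ ∀ x y : Fin n → M, StrictMono x → StrictMono y →
        (∀ i, x i ∈ H) → (∀ i, y i ∈ H) → f x = f y := by
  classical
  obtain ⟨lam, hlam⟩ := erdos_rado n (Option C) κ
  refine ⟨lam, fun M _ f S hS => ?_⟩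
  obtain ⟨H, hκ, hH⟩ := hlam S (fun s => if h : s.card = n then
    some (f fun i => s.orderEmbOfFin h i) else none) hS
  have key : ∀ x : Fin n → M, StrictMono x → (∀ i, x i ∈ Subtype.val '' H) →
      ∃ s : Finset S, (s : Set S) ⊆ H ∧ ∃ h : s.card = n, x = fun i => (s.orderEmbOfFin h i : M) := by
    intro x hx hxH
    choose z hz hzx using hxH
    have hzm : StrictMono z := fun i j hij => by
      rw [← Subtype.coe_lt_coe, hzx, hzx]; exact hx hij
    have hc : (Finset.univ.image z).card = n := by
      rw [Finset.card_image_of_injective _ hzm.injective, Finset.card_univ, Fintype.card_fin]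
    refine ⟨Finset.univ.image z, ?_, hc, ?_⟩
    · intro y hy
      obtain ⟨i, -, rfl⟩ := Finset.mem_image.1 (Finset.mem_coe.1 hy)
      exact hz i
    · have := Finset.orderEmbOfFin_unique hc (f := z)
        (fun i => Finset.mem_image_of_mem _ (Finset.mem_univ i)) hzm
      funext i
      rw [← hzx]
      exact congrArg Subtype.val (congrFun this i)
  refine ⟨Subtype.val '' H, ?_, ?_, fun x y hx hy hxH hyH => ?_⟩
  · rintro _ ⟨y, -, rfl⟩
    exact y.2
  · rwa [Cardinal.mk_image_eq Subtype.val_injective]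
  · obtain ⟨s, hs, hsc, es⟩ := key x hx hxH
    obtain ⟨t, ht, htc, et⟩ := key y hy hyH
    have := hH s t hs ht hsc htc
    rw [dif_pos hsc, dif_pos htc] at this
    rw [es, et]
    exact Option.some_injective _ this

/-- Induction on `α`. In a homogeneous set, a new point placed just after a chosen entry is a twin
of it. Adding it gives a tuple coloured like the one of value at least `γ` from the induction
hypothesis, so the original value exceeds every `γ < α`. All reorderings `σ` are treated at once
because the twin is appended at the end, out of order. -/
theorem exists_strictMono_rank_ge (α : Ordinal.{0}) : ∀ n : ℕ, ∃ lam : Cardinal.{0},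
    ∀ (M : Type) [LinearOrder M] (D : ∀ r : ℕ, (Fin (r + 1) → M) → ℕ)
      (k : ∀ r : ℕ, ℕ → Fin (r + 1)) (β : ℕ → Ordinal.{0}),
      (∀ (r : ℕ) (a : Fin (r + 1) → M) (b : M), Function.Injective a →
        b ∉ Set.range a → D r (Function.update a (k r (D r a)) b) = D r a →
        β (D (r + 1) (Fin.snoc a b)) < β (D r a)) →
      ∀ S : Set M, lam ≤ #S → ∃ x : Fin (n + 1) → M, StrictMono x ∧ (∀ i, x i ∈ S) ∧
        ∀ σ : Fin (n + 1) → Fin (n + 1), Function.Injective σ → α ≤ β (D n (x ∘ σ)) := by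
  induction α using WellFoundedLT.induction with
  | _ α ih =>
    intro n
    choose lam hlam using fun γ : α.ToType => ih (Ordinal.ToType.mk.symm γ).1
      (Ordinal.ToType.mk.symm γ).2 (n + 1)
    -- The homogeneous set must be infinite, to leave room for twins, and large enough for the
    -- induction hypothesis at every `γ < α`.
    obtain ⟨κ₁, hκ₁⟩ := exists_homogeneous (n + 1) ((Fin (n + 1) → Fin (n + 1)) → ℕ)
      (max ℵ₀ (⨆ γ, lam γ))
    obtain ⟨κ₂, hκ₂⟩ := exists_homogeneous (n + 2) ((Fin (n + 2) → Fin (n + 2)) → ℕ) κ₁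
    refine ⟨κ₂, fun M _ D k β hD S hS => ?_⟩
    obtain ⟨H₂, hHS, hcard₂, hH₂⟩ := hκ₂ M (fun x σ => D (n + 1) (x ∘ σ)) S hS
    obtain ⟨H, hHH, hcard, hH⟩ := hκ₁ M (fun x σ => D n (x ∘ σ)) H₂ hcard₂
    have hinf : H.Infinite := by
      rw [← Set.infinite_coe_iff, Cardinal.infinite_iff]
      exact (le_max_left _ _).trans hcard
    obtain ⟨T, hTH, hT⟩ := hinf.exists_subset_card_eq (2 * (n + 1))
    let e := T.orderEmbOfFin hT
    have heH : ∀ i, e i ∈ H := fun i => hTH (T.orderEmbOfFin_mem hT i)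
    -- Even positions only: the odd position after an entry is kept for its twin.
    let x : Fin (n + 1) → M := fun i => e ⟨2 * i, by omega⟩
    have hxm : StrictMono x := fun i j hij => e.strictMono (by
      have : (i : ℕ) < j := hij
      simp only [Fin.lt_def]; omega)
    have hxH : ∀ i, x i ∈ H := fun i => heH _
    refine ⟨x, hxm, fun i => hHS (hHH (hxH i)), fun σ hσ => ?_⟩
    set j := k n (D n (x ∘ σ)) with hj
    set b : M := e ⟨2 * (σ j : ℕ) + 1, by omega⟩ with hbdef
    have hbH : b ∈ H := heH _
    have hbx : ∀ i, x i ≠ b := fun i hi => by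
      have := congrArg Fin.val (e.injective hi)
      simp only at this
      omega
    have ha : Function.Injective (x ∘ σ) := hxm.injective.comp hσ
    have hb : b ∉ Set.range (x ∘ σ) := by
      rintro ⟨i, hi⟩
      exact hbx _ hi
    have hx'm : StrictMono (Function.update x (σ j) b) := by
      intro i i' hii
      have hlt : (i : ℕ) < i' := hii
      by_cases h1 : i = σ j
      · have h2 : i' ≠ σ j := fun h => by omega
        rw [h1, Function.update_self, Function.update_of_ne h2]
        refine e.strictMono ?_
        have := congrArg Fin.val h1
        simp only [Fin.lt_def]; omega
      · rw [Function.update_of_ne h1]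
        by_cases h2 : i' = σ j
        · rw [h2, Function.update_self]
          refine e.strictMono ?_
          have := congrArg Fin.val h2
          simp only [Fin.lt_def]; omega
        · rw [Function.update_of_ne h2]
          exact hxm hii
    have hx'H : ∀ i, Function.update x (σ j) b i ∈ H := by
      intro i
      by_cases h1 : i = σ j
      · rw [h1, Function.update_self]; exact hbH
      · rw [Function.update_of_ne h1]; exact hxH i
    have hDeq : D n (Function.update (x ∘ σ) j b) = D n (x ∘ σ) := by
      rw [← Function.update_comp_eq_of_injective x hσ]
      exact congrFun (hH _ _ hx'm hxm hx'H hxH) σ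
    have hlt := hD n (x ∘ σ) b ha hb hDeq
    refine le_of_forall_lt fun γ hγ => lt_of_le_of_lt ?_ hlt
    obtain ⟨z, hz, hzH, hzβ⟩ := hlam (Ordinal.ToType.mk ⟨γ, hγ⟩) M D k β hD H
      ((le_ciSup Cardinal.bddAbove_of_small _).trans ((le_max_right _ _).trans hcard))
    simp only [OrderIso.symm_apply_apply] at hzβ
    have hinj : Function.Injective (Fin.snoc (x ∘ σ) b : Fin (n + 1 + 1) → M) :=
      Fin.snoc_injective_iff.2 ⟨ha, hb⟩
    have hc : (Finset.univ.image (Fin.snoc (x ∘ σ) b : Fin (n + 1 + 1) → M)).card = n + 2 := by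
      rw [Finset.card_image_of_injective _ hinj, Finset.card_univ, Fintype.card_fin]
    set y := (Finset.univ.image (Fin.snoc (x ∘ σ) b : Fin (n + 1 + 1) → M)).orderEmbOfFin hc
    have hsnH : ∀ i, (Fin.snoc (x ∘ σ) b : Fin (n + 1 + 1) → M) i ∈ H := by
      intro i
      refine Fin.lastCases ?_ (fun i => ?_) i
      · simpa using hbH
      · simpa using hxH _
    have hyH : ∀ i, y i ∈ H := by
      intro i
      obtain ⟨i', -, hi'⟩ := Finset.mem_image.1 (Finset.orderEmbOfFin_mem _ hc i)
      exact hi' ▸ hsnH i'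
    have hτ : ∀ i, ∃ i', y i' = (Fin.snoc (x ∘ σ) b : Fin (n + 1 + 1) → M) i := by
      intro i
      have : (Fin.snoc (x ∘ σ) b : Fin (n + 1 + 1) → M) i ∈ Set.range y := by
        rw [Finset.range_orderEmbOfFin]
        exact Finset.mem_coe.2 (Finset.mem_image_of_mem _ (Finset.mem_univ i))
      exact this
    choose τ hτ using hτ
    have hyτ : y ∘ τ = (Fin.snoc (x ∘ σ) b : Fin (n + 1 + 1) → M) := funext hτ
    have hτi : Function.Injective τ := by
      intro i i' hii
      apply hinj
      rw [← hτ, ← hτ, hii]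
    rw [← hyτ]
    have := congrFun (hH₂ y z y.strictMono hz (fun i => hHH (hyH i)) (fun i => hHH (hzH i))) τ
    exact (hzβ τ hτi).trans_eq (congrArg β this.symm)

/-- There are types that are not thin. -/
theorem exists_not_thin : ∃ M : Type, ¬ Thin M := by
  obtain ⟨lam, h⟩ := exists_strictMono_rank_ge (ω_ 1) 0
  refine ⟨lam.ord.ToType, fun hT => ?_⟩
  obtain ⟨θ, hθ, D, k, β, hβ, H⟩ := hT.exists_lt
  obtain ⟨x, -, -, hx⟩ := h _ D k β H Set.univ (by simp)
  exact ((hx id Function.injective_id).trans_lt (hβ _)).not_gt hθ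

/-! ### Thinness compared with the rank of models. -/

section Rank

variable (L : FirstOrder.Language.{0, 0}) (M : Type) [L.Structure M] (κ : Cardinal.{0})

theorem rankGE_zero : RankGE L M κ 0 = RankGEZero L M κ := by
  unfold RankGE; exact Ordinal.limitRecOn_zero ..

theorem rankGE_add_one (γ : Ordinal.{0}) :
    RankGE L M κ (γ + 1) = RankStep L M (RankGE L M κ γ) := by
  unfold RankGE; exact Ordinal.limitRecOn_add_one ..

theorem rankGE_limit {δ : Ordinal.{0}} (hδ : Order.IsSuccLimit δ) (w : Set M) :
    RankGE L M κ δ w ↔ ∀ γ < δ, RankGE L M κ γ w := by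
  unfold RankGE; rw [Ordinal.limitRecOn_limit _ _ _ _ hδ]

theorem rank_le {w : Set M} {γ : Ordinal.{0}} (h : ∀ α, RankGE L M κ α w → α ≤ γ) :
    addOne (rank L M κ w) ≤ ((γ + 1 : Ordinal.{0}) : WithTop Ordinal.{0}) := by
  have h1 : rank L M κ w ≤ ((γ : WithTop Ordinal.{0}) : WithBot (WithTop Ordinal.{0})) := by
    refine sSup_le ?_
    rintro _ ⟨α, rfl, hα⟩
    exact WithBot.coe_le_coe.2 (WithTop.coe_le_coe.2 (h α hα))
  generalize rank L M κ w = x at h1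
  induction x using WithBot.recBotCoe with
  | bot => exact zero_le
  | coe x =>
    have h2 := WithBot.coe_le_coe.1 h1
    change x + 1 ≤ _
    rw [WithTop.coe_add]
    exact add_le_add_left h2 1

theorem le_addOne_rank {w : Set M} {γ : Ordinal.{0}} (h : RankGE L M κ γ w) :
    ((γ + 1 : Ordinal.{0}) : WithTop Ordinal.{0}) ≤ addOne (rank L M κ w) := by
  have h1 : ((γ : WithTop Ordinal.{0}) : WithBot (WithTop Ordinal.{0})) ≤ rank L M κ w :=
    le_sSup ⟨γ, rfl, h⟩
  generalize rank L M κ w = x at h1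
  induction x using WithBot.recBotCoe with
  | bot => exact absurd h1 (by simp)
  | coe x =>
    have h2 := WithBot.coe_le_coe.1 h1
    change _ ≤ x + 1
    rw [WithTop.coe_add]
    exact add_le_add_left h2 1

end Rank

/-- The language with countably many relation symbols of each arity and no function symbols. -/
def colourLanguage : FirstOrder.Language.{0, 0} := ⟨fun _ => Empty, fun _ => ℕ⟩

theorem card_colourLanguage_le : colourLanguage.card ≤ ℵ₀ := by
  rw [FirstOrder.Language.card, Cardinal.mk_le_aleph0_iff]
  have h1 : ∀ l, Countable (colourLanguage.Functions l) := fun _ =>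
    inferInstanceAs (Countable Empty)
  have h2 : ∀ l, Countable (colourLanguage.Relations l) := fun _ =>
    inferInstanceAs (Countable ℕ)
  unfold FirstOrder.Language.Symbols
  infer_instance

/-- The structure in which the relations are the colour classes of `D` on injective tuples. -/
abbrev colourStructure {M : Type} (D : ∀ r : ℕ, (Fin (r + 1) → M) → ℕ) :
    colourLanguage.Structure M where
  funMap := fun f => Empty.elim f
  RelMap := fun {n} d x => match n, x with
    | 0, _ => False
    | r + 1, x => Function.Injective x ∧ D r x = d

/-- With the colour classes as relations, apply the successor step to the colour of `a` and the
coordinate that it prescribes: it yields a twin of `a`. The relations hold only of injective tuples,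
so the twin is a new point. Hence the rank of a tuple is at most its `β`. -/
theorem Thin.not_rankProperty {M : Type} (h : Thin M) :
    ¬ RankProperty (ω_ 1) #M (Order.succ ℵ₀) ℵ₀ := by
  obtain ⟨θ, hθ, D, k, β, hβ, H⟩ := h.exists_lt
  let _ := colourStructure D
  intro hP
  have hP := hP colourLanguage M card_colourLanguage_le rfl
  have key : ∀ γ : Ordinal.{0}, ∀ (r : ℕ) (a : Fin (r + 1) → M), Function.Injective a →
      RankGE colourLanguage M (Order.succ ℵ₀) γ (Set.range a) → γ ≤ β (D r a) := by
    intro γ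
    induction γ using Ordinal.limitRecOn with
    | zero => exact fun _ _ _ _ => zero_le
    | add_one γ ih =>
      intro r a ha hR
      rw [Order.add_one_le_iff]
      rw [rankGE_add_one] at hR
      let φ : colourLanguage.Formula (Fin (r + 1)) :=
        FirstOrder.Language.Relations.formula (L := colourLanguage) (n := r + 1) (D r a)
          fun i => FirstOrder.Language.Term.var i
      have hφ : ∀ x : Fin (r + 1) → M, φ.Realize x ↔ Function.Injective x ∧ D r x = D r a := by
        intro x
        exact Iff.rfl
      obtain ⟨c, hc, hr, hne, heq, h0⟩ := hR.2.2 (r + 1) a ha rfl (k r (D r a)) φ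
        (FirstOrder.Language.BoundedFormula.IsAtomic.isQF
          (FirstOrder.Language.BoundedFormula.IsAtomic.rel _ _)) ((hφ a).2 ⟨ha, rfl⟩)
      set j := k r (D r a) with hj
      have hc0 : c 0 = a := funext fun m => (h0 m).symm
      have hc1 : c 1 = Function.update a j (c 1 j) := by
        funext m
        by_cases hm : m = j
        · subst hm; simp
        · rw [Function.update_of_ne hm, ← heq m hm, hc0]
      obtain ⟨hi1, hD1⟩ := (hφ _).1 (hr 1)
      have hb : c 1 j ∉ Set.range a := by
        rintro ⟨m, hm⟩
        by_cases hmj : m = j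
        · subst hmj; rw [hc0] at hne; exact hne hm
        · rw [h0, heq m hmj] at hm
          exact hmj (hi1 hm)
      rw [hc1] at hD1
      refine lt_of_le_of_lt (ih (r + 1) (Fin.snoc a (c 1 j)) (Fin.snoc_injective_iff.2 ⟨ha, hb⟩) ?_)
        (H r a (c 1 j) ha hb hD1)
      have hs : {x | ∃ i m, x = c i m} =
          Set.range (Fin.snoc a (c 1 j) : Fin (r + 1 + 1) → M) := by
        rw [Fin.range_snoc]
        ext x
        simp only [Set.mem_ofPred_eq, Fin.exists_fin_two, hc0, Set.mem_insert_iff, Set.mem_range]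
        constructor
        · rintro (⟨m, rfl⟩ | ⟨m, rfl⟩)
          · exact Or.inr ⟨m, rfl⟩
          · by_cases hm : m = j
            · exact Or.inl (hm ▸ rfl)
            · exact Or.inr ⟨m, by rw [← hc0, heq m hm]⟩
        · rintro (rfl | ⟨m, rfl⟩)
          · exact Or.inr ⟨j, rfl⟩
          · exact Or.inl ⟨m, rfl⟩
      rwa [hs] at hc
    | limit δ hδ ih =>
      intro r a ha hR
      rw [rankGE_limit _ _ _ hδ] at hR
      exact (hδ.isSuccPrelimit.le_iff_forall_le).2 fun γ hγ => ih γ hγ r a ha (hR γ hγ)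
  have hle : modelRank colourLanguage M (Order.succ ℵ₀) ≤ (θ : WithTop Ordinal.{0}) := by
    refine iSup_le ?_
    rintro ⟨w, hw, hne⟩
    have := hw.to_subtype
    obtain ⟨n, ⟨e⟩⟩ := Finite.exists_equiv_fin w
    obtain ⟨r, rfl⟩ : ∃ r, n = r + 1 := Nat.exists_eq_succ_of_ne_zero fun h0 => by
      subst h0
      exact (e ⟨_, hne.some_mem⟩).elim0
    let a : Fin (r + 1) → M := fun i => e.symm i
    have hai : Function.Injective a := Subtype.val_injective.comp e.symm.injective
    have haw : Set.range a = w := by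
      change Set.range (Subtype.val ∘ e.symm) = w
      rw [Set.range_comp Subtype.val e.symm, e.symm.range_eq_univ, Set.image_univ,
        Subtype.range_coe]
    refine (rank_le colourLanguage M _ fun α hα => key α r a hai (haw ▸ hα)).trans ?_
    exact WithTop.coe_le_coe.2 (Order.add_one_le_of_lt (hβ _))
  exact (hP.trans hle).not_gt (WithTop.coe_lt_coe.2 hθ)

section

variable {L : FirstOrder.Language.{0, 0}} {M : Type} [L.Structure M]

variable (L) in
/-- The least ordinal to which the rank of `w` does not reach. -/
noncomputable def rankBound (w : Set M) : Ordinal.{0} :=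
  sInf {γ | ¬ RankGE L M (Order.succ ℵ₀) γ w}

/-- The first ordinal that the rank fails to reach is never a limit. If it is zero, some entry is
algebraic over the others. If it is a successor, a formula and a coordinate defeat the successor
step, so adding any twin lowers the bound. -/
theorem exists_formula_of_not_rankGE {r : ℕ} (a : Fin (r + 1) → M) 
    (hw : ∃ γ, ¬ RankGE L M (Order.succ ℵ₀) γ (Set.range a)) :
    ∃ (k : Fin (r + 1)) (ψ : L.Formula (Fin (r + 1))), ψ.Realize a ∧
      ({x | ψ.Realize (Function.update a k x)}.Countable ∨
        ∀ b ∉ Set.range a, ψ.Realize (Function.update a k b) →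
          rankBound L (insert b (Set.range a)) < rankBound L (Set.range a)) := by
  have hfin : (Set.range a).Finite := Set.finite_range a
  have hmin : ¬ RankGE L M (Order.succ ℵ₀) (rankBound L (Set.range a)) (Set.range a) :=
    csInf_mem (s := {γ | ¬ RankGE L M (Order.succ ℵ₀) γ (Set.range a)}) hw
  have hbelow : ∀ γ < rankBound L (Set.range a), RankGE L M (Order.succ ℵ₀) γ (Set.range a) := by
    intro γ hγ
    by_contra hc
    exact notMem_of_lt_csInf' hγ hc
  generalize hρ : rankBound L (Set.range a) = ρ at hmin hbelow
  induction ρ using Ordinal.limitRecOn with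
  | zero =>
    rw [rankGE_zero] at hmin
    simp only [RankGEZero, hfin, Set.range_nonempty, true_and, not_forall, not_not] at hmin
    obtain ⟨_, ⟨k, rfl⟩, n, φ, b, -, hb, hφ, hcard⟩ := hmin
    choose g hg using fun i => (hb i).1
    have hgk : ∀ i, g i ≠ k := fun i hi => (hb i).2 (by rw [← hg i, hi]; rfl)
    have e : ∀ x, Function.update a k x ∘ (Fin.cons k g : Fin (n + 1) → Fin (r + 1)) =
        (Fin.cons x b : Fin (n + 1) → M) := by
      intro x
      funext i
      refine Fin.cases ?_ (fun i => ?_) i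
      · simp
      · simp [Function.update_of_ne (hgk i), hg]
    refine ⟨k, φ.relabel (Fin.cons k g : Fin (n + 1) → Fin (r + 1)), ?_, Or.inl ?_⟩
    · rw [FirstOrder.Language.Formula.realize_relabel]
      have := e (a k)
      rw [Function.update_eq_self] at this
      rwa [this]
    · simp only [FirstOrder.Language.Formula.realize_relabel, e]
      rwa [← Set.countable_coe_iff, ← Cardinal.mk_le_aleph0_iff, ← Order.lt_succ_iff]
  | add_one γ _ =>
    rw [rankGE_add_one] at hmin
    simp only [RankStep, hfin, Set.range_nonempty, true_and, not_forall] at hmin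
    obtain ⟨n, a', ha'i, hr, k, φ, -, hφ, hno⟩ := hmin
    -- The failing enumeration `a'` may list the range in another order than `a`; `σ` translates
    -- between them.
    have hσ : ∀ i, ∃ j, a j = a' i := fun i => by
      have : a' i ∈ Set.range a := hr ▸ Set.mem_range_self i
      exact this
    choose σ hσ using hσ
    have ha' : a ∘ σ = a' := funext hσ
    refine ⟨σ k, φ.relabel σ, ?_, Or.inr fun b hb hψ => ?_⟩
    · rwa [FirstOrder.Language.Formula.realize_relabel, ha']
    rw [FirstOrder.Language.Formula.realize_relabel] at hψ
    refine lt_of_le_of_lt (csInf_le' ?_) (Order.lt_add_one_iff.2 le_rfl)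
    intro hR
    refine hno ⟨![a', Function.update a (σ k) b ∘ σ], ?_, ?_, ?_, ?_, ?_⟩
    · convert hR using 1
      ext x
      simp only [Fin.exists_fin_two, Set.mem_ofPred_eq, Matrix.cons_val_zero, Matrix.cons_val_one,
        Set.mem_insert_iff]
      constructor
      · rintro (⟨m, rfl⟩ | ⟨m, rfl⟩)
        · exact Or.inr (hr ▸ Set.mem_range_self m)
        · by_cases hm : σ m = σ k
          · simp [hm]
          · simp [Function.update_of_ne hm]
      · rintro (rfl | hx)
        · exact Or.inr ⟨k, by simp⟩
        · rw [← hr] at hx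
          obtain ⟨m, rfl⟩ := hx
          exact Or.inl ⟨m, rfl⟩
    · intro i
      fin_cases i
      · exact hφ
      · exact hψ
    · simp only [Matrix.cons_val_zero, Matrix.cons_val_one, Function.comp_apply,
        Function.update_self]
      rintro rfl
      exact hb (hr ▸ Set.mem_range_self k)
    · intro m hm
      have hne : σ m ≠ σ k := fun h => hm (ha'i (by rw [← hσ, ← hσ, h]))
      simp [Function.update_of_ne hne, hσ]
    · exact fun _ => rfl
  | limit δ hδ _ =>
    exact (hmin ((rankGE_limit _ _ _ hδ _).2 hbelow)).elim

-- The colour of a tuple consists of its defeating formula and coordinate, its rank bound, and a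
-- code of the chosen entry among the solutions, injective when these are countable. In that case a
-- twin of equal colour would be the entry itself; otherwise the bound drops.
open Classical in
theorem thin_of_modelRank_lt (hL : L.card ≤ ℵ₀)
    (h : modelRank L M (Order.succ ℵ₀) < ((ω_ 1 : Ordinal.{0}) : WithTop Ordinal.{0})) :
    Thin M := by
  obtain ⟨θ, hθ⟩ := WithTop.ne_top_iff_exists.1 (h.trans_le le_top).ne
  have hθ1 : θ < ω_ 1 := WithTop.coe_lt_coe.1 (hθ ▸ h)
  have hθ := hθ.symm
  have hnot : ∀ w : Set M, w.Finite → w.Nonempty → ¬ RankGE L M (Order.succ ℵ₀) θ w := by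
    intro w hw hne hR
    have h1 := (le_addOne_rank L M _ hR).trans (le_iSup
      (fun w : {w : Set M // w.Finite ∧ w.Nonempty} => addOne (rank L M (Order.succ ℵ₀) w))
      ⟨w, hw, hne⟩)
    change _ ≤ modelRank L M (Order.succ ℵ₀) at h1
    rw [hθ] at h1
    exact (Order.lt_add_one_iff.2 le_rfl).not_ge (WithTop.coe_le_coe.1 h1)
  choose k ψ hψ hkψ using fun (r : ℕ) (a : Fin (r + 1) → M) =>
    exists_formula_of_not_rankGE (L := L) a
      ⟨θ, hnot _ (Set.finite_range a) (Set.range_nonempty a)⟩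
  have hcode : ∀ S : Set M, ∃ f : M → ℕ, S.Countable → Set.InjOn f S := by
    intro S
    by_cases hS : S.Countable
    · obtain ⟨f, hf⟩ := Set.countable_iff_exists_injOn.1 hS
      exact ⟨f, fun _ => hf⟩
    · exact ⟨fun _ => 0, fun h => (hS h).elim⟩
  choose code hcode using hcode
  have hc : Countable (Σ r, L.Formula (Fin (r + 1))) := by
    have : ∀ r, Countable (L.Formula (Fin (r + 1))) := fun r => by
      have h1 := FirstOrder.Language.BoundedFormula.card_le (L := L) (α := Fin (r + 1))
      have h2 : Countable (Σ n, L.BoundedFormula (Fin (r + 1)) n) := by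
        rw [← Cardinal.mk_le_aleph0_iff]
        refine h1.trans (max_le le_rfl ?_)
        simp only [Cardinal.lift_id]
        exact Cardinal.add_le_aleph0.2 ⟨Cardinal.mk_le_aleph0, hL⟩
      exact (sigma_mk_injective (β := fun n => L.BoundedFormula (Fin (r + 1)) n)
        (i := 0)).countable
    infer_instance
  refine ⟨_, ThinBelow.of_tuple (θ := θ + 1) ((Cardinal.isSuccLimit_omega 1).add_one_lt hθ1)
    (fun r a => ((⟨r, ψ r a⟩ : Σ r, L.Formula (Fin (r + 1))),
      code {x | (ψ r a).Realize (Function.update a (k r a) x)} (a (k r a)))) k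
    (fun r a => rankBound L (Set.range a)) (fun r a => Order.lt_add_one_iff.2 (csInf_le'
      (hnot _ (Set.finite_range a) (Set.range_nonempty a)))) (by simp) ?_⟩
  intro r a b ha hb hD hk _
  simp only [Prod.mk.injEq, Sigma.mk.injEq, heq_eq_eq, true_and] at hD
  obtain ⟨h1, h2⟩ := hD
  have h3 := hψ r (Function.update a (k r a) b)
  rw [h1] at h3
  rw [h1, hk] at h2
  -- The solution set ignores the old value of the chosen coordinate, so both codes refer to the
  -- same set.
  simp only [Function.update_idem, Function.update_self] at h2
  rcases hkψ r a with hS | hS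
  · refine (hb ⟨k r a, ?_⟩).elim
    refine (hcode _ hS ?_ ?_ h2).symm
    · exact h3
    · change (ψ r a).Realize _
      rw [Function.update_eq_self]
      exact hψ r a
  · rw [Fin.range_snoc]
    exact hS b hb h3

end

/-- The rank property that defines `λ_{ω₁}(ℵ₀)` is the failure of thinness. -/
theorem rankProperty_iff_not_thin (M : Type) :
    RankProperty (ω_ 1) #M (Order.succ ℵ₀) ℵ₀ ↔ ¬ Thin M := by
  refine ⟨fun h hT => hT.not_rankProperty h, fun h L N _ hL hN => ?_⟩
  by_contra hc
  exact h ((thin_of_modelRank_lt hL (not_le.1 hc)).of_mk_le hN.ge)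

/-- `λ_{ω₁}(ℵ₀)` is the least cardinal that is not thin. -/
theorem mk_lt_lambda_iff (M : Type) : #M < lambda (ω_ 1) ℵ₀ ↔ Thin M := by
  have hne : {lam | RankProperty (ω_ 1) lam (Order.succ ℵ₀) ℵ₀}.Nonempty := by
    obtain ⟨M, hM⟩ := exists_not_thin
    exact ⟨#M, (rankProperty_iff_not_thin M).2 hM⟩
  constructor
  · intro h
    by_contra hc
    exact notMem_of_lt_csInf' h ((rankProperty_iff_not_thin M).2 hc)
  · intro h
    by_contra! hc
    have h1 : RankProperty (ω_ 1) (lambda (ω_ 1) ℵ₀) (Order.succ ℵ₀) ℵ₀ := csInf_mem hne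
    rw [← Cardinal.mk_out (lambda (ω_ 1) ℵ₀), rankProperty_iff_not_thin] at h1
    exact h1 (h.of_mk_le ((Cardinal.mk_out _).trans_le hc))

/-! ### The forcing and its countable chain condition. -/

/-- `x` and `y` have the same first `n` terms. -/
def Agree (n : ℕ) (x y : ℕ → Bool) : Prop := ∀ l < n, x l = y l

theorem Agree.rfl {n : ℕ} {x : ℕ → Bool} : Agree n x x := fun _ _ => Eq.refl _

theorem Agree.symm {n : ℕ} {x y : ℕ → Bool} (h : Agree n x y) : Agree n y x :=
  fun l hl => (h l hl).symm

theorem Agree.trans {n : ℕ} {x y z : ℕ → Bool} (h : Agree n x y) (h' : Agree n y z) :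
    Agree n x z := fun l hl => (h l hl).trans (h' l hl)

theorem Agree.mono {n m : ℕ} {x y : ℕ → Bool} (h : Agree n x y) (hm : m ≤ n) : Agree m x y :=
  fun l hl => h l (hl.trans_le hm)

/-- Finite approximations to a sequence of reals indexed by `M` together with a colouring of the
pairs from `M`. -/
structure Cond {M : Type} (D : ∀ r : ℕ, (Fin (r + 1) → M) → ℕ) where
  /-- the indices decided so far -/
  u : Finset M
  /-- the length of the initial segments -/
  n : ℕ
  /-- the number of colours -/
  N : ℕ
  /-- the initial segments -/
  η : M → ℕ → Bool
  /-- the colouring -/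
  h : M → M → ℕ
  sep : ∀ i ∈ u, ∀ j ∈ u, Agree n (η i) (η j) → i = j
  h_lt : ∀ i ∈ u, ∀ j ∈ u, i ≠ j → h i j < N
  h_symm : ∀ i j, h i j = h j i

namespace Cond

variable {M : Type} {D : ∀ r : ℕ, (Fin (r + 1) → M) → ℕ}

/-- The order of the forcing. A pair that gets an old colour resembles an old pair, and a tuple
that resembles an old one has the same value of `D`. -/
structure Le (p q : Cond D) : Prop where
  u : p.u ⊆ q.u
  n : p.n ≤ q.n
  N : p.N ≤ q.N
  η : ∀ i ∈ p.u, Agree p.n (q.η i) (p.η i)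
  h : ∀ i ∈ p.u, ∀ j ∈ p.u, i ≠ j → q.h i j = p.h i j
  pairs : ∀ i ∈ q.u, ∀ j ∈ q.u, i ≠ j → q.h i j < p.N → ∃ i' ∈ p.u, ∃ j' ∈ p.u, i' ≠ j' ∧
    Agree p.n (q.η i) (p.η i') ∧ Agree p.n (q.η j) (p.η j') ∧ p.h i' j' = q.h i j
  tuples : ∀ (r : ℕ) (b a : Fin (r + 2) → M), (∀ i, b i ∈ q.u) → (∀ i, a i ∈ p.u) →
    Function.Injective a → (∀ i, Agree p.n (q.η (b i)) (p.η (a i))) →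
    (∀ i j, i ≠ j → q.h (b i) (b j) = p.h (a i) (a j)) → D (r + 1) b = D (r + 1) a

theorem Le.refl (p : Cond D) : Le p p where
  u := Finset.Subset.refl _
  n := le_rfl
  N := le_rfl
  η _ _ := Agree.rfl
  h _ _ _ _ _ := rfl
  pairs i hi j hj hij _ := ⟨i, hi, j, hj, hij, Agree.rfl, Agree.rfl, rfl⟩
  tuples r b a hb ha _ hba _ := by
    rw [funext fun i => p.sep _ (hb i) _ (ha i) (hba i)]

theorem Le.trans {p q s : Cond D} (hpq : Le p q) (hqs : Le q s) : Le p s where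
  u := hpq.u.trans hqs.u
  n := hpq.n.trans hqs.n
  N := hpq.N.trans hqs.N
  η i hi := ((hqs.η i (hpq.u hi)).mono hpq.n).trans (hpq.η i hi)
  h i hi j hj hij := (hqs.h i (hpq.u hi) j (hpq.u hj) hij).trans (hpq.h i hi j hj hij)
  pairs i hi j hj hij hlt := by
    obtain ⟨i', hi', j', hj', hij', h1, h2, h3⟩ :=
      hqs.pairs i hi j hj hij (hlt.trans_le hpq.N)
    obtain ⟨i'', hi'', j'', hj'', hij'', h4, h5, h6⟩ :=
      hpq.pairs i' hi' j' hj' hij' (h3 ▸ hlt)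
    exact ⟨i'', hi'', j'', hj'', hij'', (h1.mono hpq.n).trans h4, (h2.mono hpq.n).trans h5,
      h6.trans h3⟩
  tuples r b a hb ha hai hba hh := by
    have hbne : ∀ i j, i ≠ j → b i ≠ b j := fun i j hij hc => hij <| hai <|
      p.sep _ (ha i) _ (ha j) ((hba i).symm.trans (hc ▸ hba j))
    have hlt : ∀ i j, i ≠ j → s.h (b i) (b j) < q.N := fun i j hij => by
      rw [hh i j hij]
      exact (p.h_lt _ (ha i) _ (ha j) (hai.ne hij)).trans_le hpq.N
    -- Each entry has a partner because tuples have length at least two. Their colour is old, so the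
    -- `pairs` clause matches the entry with an index of `q`, and the two `tuples` clauses can be
    -- chained.
    have hc : ∀ i, ∃ c ∈ q.u, Agree q.n (s.η (b i)) (q.η c) := fun i => by
      obtain ⟨j, hj⟩ := exists_ne i
      obtain ⟨c, hc, _, _, _, h1, _⟩ := hqs.pairs _ (hb i) _ (hb j) (hbne i j hj.symm)
        (hlt i j hj.symm)
      exact ⟨c, hc, h1⟩
    choose c hc hbc using hc
    have hca : ∀ i, Agree p.n (q.η (c i)) (p.η (a i)) := fun i =>
      ((hbc i).mono hpq.n).symm.trans (hba i)
    have hsc : ∀ i j, i ≠ j → s.h (b i) (b j) = q.h (c i) (c j) := fun i j hij => by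
      obtain ⟨c', hc', d', hd', _, h1, h2, h3⟩ := hqs.pairs _ (hb i) _ (hb j) (hbne i j hij)
        (hlt i j hij)
      rw [q.sep _ (hc i) _ hc' ((hbc i).symm.trans h1),
        q.sep _ (hc j) _ hd' ((hbc j).symm.trans h2), h3]
    have hci : Function.Injective c := fun i j hij => hai <| p.sep _ (ha i) _ (ha j) <|
      (hca i).symm.trans (hij ▸ hca j)
    exact (hqs.tuples r b c hb hc hci hbc hsc).trans (hpq.tuples r c a hc ha hai hca
      fun i j hij => (hsc i j hij).symm.trans (hh i j hij))

instance : Preorder (Cond D) where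
  le := Le
  le_refl := Le.refl
  le_trans _ _ _ := Le.trans

/-- Two conditions enumerated by `Fin c` that look alike. -/
structure Twins (p q : Cond D) {c : ℕ} (e e' : Fin c → M) : Prop where
  n : p.n = q.n
  N : p.N = q.N
  mem : ∀ i, e i ∈ p.u
  mem' : ∀ i, e' i ∈ q.u
  surj : ∀ x ∈ p.u, ∃ i, e i = x
  surj' : ∀ x ∈ q.u, ∃ i, e' i = x
  η : ∀ i, Agree p.n (p.η (e i)) (q.η (e' i))
  h : ∀ i j, i ≠ j → p.h (e i) (e j) = q.h (e' i) (e' j)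
  D : ∀ (r : ℕ) (t : Fin (r + 2) → Fin c), Function.Injective t →
    D (r + 1) (e ∘ t) = D (r + 1) (e' ∘ t)
  root : ∀ i j, e i = e' j → i = j

theorem Twins.symm {p q : Cond D} {c : ℕ} {e e' : Fin c → M} (h : Twins p q e e') :
    Twins q p e' e where
  n := h.n.symm
  N := h.N.symm
  mem := h.mem'
  mem' := h.mem
  surj := h.surj'
  surj' := h.surj
  η i := h.n ▸ (h.η i).symm
  h i j hij := (h.h i j hij).symm
  D r t ht := (h.D r t ht).symm
  root i j hij := (h.root j i hij.symm).symm

/-- If old colours occur only inside `p.u` or inside `q.u`, a tuple resembling one of `p` lies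
wholly in one of the two sets. In `q.u` the twin correspondence carries it to the tuple of `p`; in
`p.u` separation makes the two equal. -/
theorem Twins.le {p q s : Cond D} {c : ℕ} {e e' : Fin c → M} (T : Twins p q e e')
    (hu : p.u ⊆ s.u) (hn : p.n ≤ s.n) (hN : p.N ≤ s.N)
    (hp : ∀ i ∈ p.u, Agree p.n (s.η i) (p.η i)) (hq : ∀ i ∈ q.u, Agree p.n (s.η i) (q.η i))
    (hph : ∀ i ∈ p.u, ∀ j ∈ p.u, i ≠ j → s.h i j = p.h i j)
    (hqh : ∀ i ∈ q.u, ∀ j ∈ q.u, i ≠ j → s.h i j = q.h i j)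
    (hs : ∀ i ∈ s.u, ∀ j ∈ s.u, i ≠ j → s.h i j < p.N →
      (i ∈ p.u ∧ j ∈ p.u) ∨ (i ∈ q.u ∧ j ∈ q.u)) : p ≤ s where
  u := hu
  n := hn
  N := hN
  η := hp
  h := hph
  pairs i hi j hj hij hlt := by
    rcases hs i hi j hj hij hlt with ⟨hi', hj'⟩ | ⟨hi', hj'⟩
    · exact ⟨i, hi', j, hj', hij, hp i hi', hp j hj', (hph i hi' j hj' hij).symm⟩
    · have h1 := hqh i hi' j hj' hij
      have h2 := hq i hi'
      have h3 := hq j hj'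
      obtain ⟨i, rfl⟩ := T.surj' i hi'
      obtain ⟨j, rfl⟩ := T.surj' j hj'
      have hne : i ≠ j := fun h => hij (h ▸ rfl)
      refine ⟨e i, T.mem i, e j, T.mem j, fun hc => hne ?_, h2.trans (T.η i).symm,
        h3.trans (T.η j).symm, (T.h i j hne).trans h1.symm⟩
      have h4 := q.sep _ hi' _ hj' (T.n ▸ (T.η i).symm.trans (hc ▸ T.η j))
      exact (hij h4).elim
  tuples r b a hb ha hai hba hh := by
    have hbne : ∀ i j, i ≠ j → b i ≠ b j := fun i j hij hc => hij <| hai <|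
      p.sep _ (ha i) _ (ha j) ((hba i).symm.trans (hc ▸ hba j))
    have hpair : ∀ i j, i ≠ j → (b i ∈ p.u ∧ b j ∈ p.u) ∨ (b i ∈ q.u ∧ b j ∈ q.u) :=
      fun i j hij => hs _ (hb i) _ (hb j) (hbne i j hij) <| by
        rw [hh i j hij]
        exact p.h_lt _ (ha i) _ (ha j) (hai.ne hij)
    by_cases hall : ∀ i, b i ∈ q.u
    · choose t ht using fun i => T.surj' _ (hall i)
      have hta : ∀ i, e (t i) = a i := fun i => p.sep _ (T.mem _) _ (ha i) <| by
        have h1 := hq _ (hall i)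
        rw [← ht i] at h1
        have h2 := hba i
        rw [← ht i] at h2
        exact (T.η (t i)).trans (h1.symm.trans h2)
      have hti : Function.Injective t := fun i j hij => hai (by rw [← hta, ← hta, hij])
      rw [← funext ht, ← funext hta]
      exact (T.D r t hti).symm
    · push Not at hall
      obtain ⟨i, hi⟩ := hall
      have hbp : ∀ j, b j ∈ p.u := fun j => by
        rcases eq_or_ne i j with rfl | hij
        · obtain ⟨j, hj⟩ := exists_ne i
          rcases hpair i j hj.symm with h | h
          · exact h.1
          · exact (hi h.1).elim
        · rcases hpair i j hij with h | h
          · exact h.2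
          · exact (hi h.1).elim
      rw [funext fun j => p.sep _ (hbp j) _ (ha j) ((hp _ (hbp j)).symm.trans (hba j))]

theorem exists_twins_self (p : Cond D) : ∃ (c : ℕ) (e : Fin c → M), Function.Injective e ∧
    Twins p p e e := by
  have hinj : Function.Injective fun i => (p.u.equivFin.symm i : M) :=
    Subtype.val_injective.comp p.u.equivFin.symm.injective
  refine ⟨p.u.card, fun i => p.u.equivFin.symm i, hinj,
    rfl, rfl, fun i => (p.u.equivFin.symm i).2, fun i => (p.u.equivFin.symm i).2, ?_, ?_,
    fun _ => Agree.rfl, fun _ _ _ => rfl, fun _ _ _ => rfl, fun _ _ h => hinj h⟩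
  · exact fun x hx => ⟨p.u.equivFin ⟨x, hx⟩, by simp⟩
  · exact fun x hx => ⟨p.u.equivFin ⟨x, hx⟩, by simp⟩

-- Amalgamation on the union: one extra digit tells `p.u` from the rest, and pairs inside neither
-- set receive the new colour `p.N`.
open Classical in
theorem Twins.compatible {p q : Cond D} {c : ℕ} {e e' : Fin c → M} (T : Twins p q e e') :
    Compatible p q := by
  let η : M → ℕ → Bool := fun i l =>
    if l < p.n then (if i ∈ p.u then p.η i l else q.η i l) else decide (i ∈ p.u)
  let h : M → M → ℕ := fun i j => if i ∈ p.u ∧ j ∈ p.u then p.h i j else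
    if i ∈ q.u ∧ j ∈ q.u then q.h i j else p.N
  have hp : ∀ i ∈ p.u, Agree p.n (η i) (p.η i) := fun i hi l hl => by simp [η, hl, hi]
  have hq : ∀ i ∈ q.u, Agree p.n (η i) (q.η i) := fun i hi => by
    by_cases hip : i ∈ p.u
    · refine (hp i hip).trans ?_
      obtain ⟨j, rfl⟩ := T.surj i hip
      obtain ⟨j', hj'⟩ := T.surj' _ hi
      have := T.root j j' hj'.symm
      have h2 := T.η j
      rwa [this, hj', ← this] at h2
    · intro l hl
      simp [η, hl, hip]
  have hph : ∀ i ∈ p.u, ∀ j ∈ p.u, i ≠ j → h i j = p.h i j := fun i hi j hj _ => by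
    simp [h, hi, hj]
  have hqh : ∀ i ∈ q.u, ∀ j ∈ q.u, i ≠ j → h i j = q.h i j := fun i hi j hj hij => by
    by_cases hp' : i ∈ p.u ∧ j ∈ p.u
    · rw [hph i hp'.1 j hp'.2 hij]
      obtain ⟨k, rfl⟩ := T.surj i hp'.1
      obtain ⟨k', hk'⟩ := T.surj' _ hi
      obtain ⟨m, rfl⟩ := T.surj j hp'.2
      obtain ⟨m', hm'⟩ := T.surj' _ hj
      have h1 := T.root k k' hk'.symm
      have h2 := T.root m m' hm'.symm
      rw [T.h k m fun hc => hij (hc ▸ rfl), h1, hk', ← h1, h2, hm', ← h2]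
    · simp [h, hp', hi, hj]
  have hs : ∀ i ∈ p.u ∪ q.u, ∀ j ∈ p.u ∪ q.u, i ≠ j → h i j < p.N →
      (i ∈ p.u ∧ j ∈ p.u) ∨ (i ∈ q.u ∧ j ∈ q.u) := fun i _ j _ _ hlt => by
    by_contra hc
    push Not at hc
    have h1 : ¬ (i ∈ p.u ∧ j ∈ p.u) := fun hh => hc.1 hh.1 hh.2
    have h2 : ¬ (i ∈ q.u ∧ j ∈ q.u) := fun hh => hc.2 hh.1 hh.2
    simp [h, h1, h2] at hlt
  let s : Cond D :=
    { u := p.u ∪ q.u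
      n := p.n + 1
      N := p.N + 1
      η := η
      h := h
      sep := fun i hi j hj hij => by
        have h1 : decide (i ∈ p.u) = decide (j ∈ p.u) := by
          simpa [η] using hij p.n (Nat.lt_succ_self _)
        have h1 : i ∈ p.u ↔ j ∈ p.u := by simpa using h1
        have h2 := hij.mono (Nat.le_succ _)
        by_cases hip : i ∈ p.u
        · exact p.sep _ hip _ (h1.1 hip)
            ((hp _ hip).symm.trans (h2.trans (hp _ (h1.1 hip))))
        · have hiq := (Finset.mem_union.1 hi).resolve_left hip
          have hjq := (Finset.mem_union.1 hj).resolve_left fun hc => hip (h1.2 hc)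
          exact q.sep _ hiq _ hjq (T.n ▸ (hq _ hiq).symm.trans (h2.trans (hq _ hjq)))
      h_lt := fun i hi j hj hij => by
        by_contra hc
        have hc' : p.N + 1 ≤ h i j := not_lt.1 hc
        by_cases h1 : i ∈ p.u ∧ j ∈ p.u
        · have := p.h_lt i h1.1 j h1.2 hij
          rw [hph i h1.1 j h1.2 hij] at hc'
          omega
        · by_cases h2 : i ∈ q.u ∧ j ∈ q.u
          · have := q.h_lt i h2.1 j h2.2 hij
            rw [hqh i h2.1 j h2.2 hij] at hc'
            have := T.N
            omega
          · simp [h, h1, h2] at hc'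
      h_symm := fun i j => by
        simp only [h, and_comm, p.h_symm i j, q.h_symm i j] }
  refine ⟨s, T.le Finset.subset_union_left (Nat.le_succ _) (Nat.le_succ _) hp hq hph hqh hs,
    T.symm.le Finset.subset_union_right (T.n ▸ Nat.le_succ _) (T.N ▸ Nat.le_succ _)
      (T.n ▸ hq) (T.n ▸ hp) hqh hph fun i hi j hj hij hlt => (hs i hi j hj hij (T.N ▸ hlt)).symm⟩

-- The new index is set apart by a fresh digit and its pairs by a fresh colour; `p` acts as its own
-- twin in `Twins.le`.
open Classical in
theorem exists_le_mem (p : Cond D) (x : M) : ∃ q, p ≤ q ∧ x ∈ q.u := by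
  by_cases hx : x ∈ p.u
  · exact ⟨p, le_rfl, hx⟩
  obtain ⟨c, e, -, T⟩ := exists_twins_self p
  let η : M → ℕ → Bool := fun i l => if l < p.n then p.η i l else decide (i = x)
  let h : M → M → ℕ := fun i j => if i = x ∨ j = x then p.N else p.h i j
  have hη : ∀ i, Agree p.n (η i) (p.η i) := fun i l hl => by simp [η, hl]
  have hh : ∀ i ∈ p.u, ∀ j ∈ p.u, i ≠ j → h i j = p.h i j := fun i hi j hj _ => by
    have h1 : i ≠ x := fun hc => hx (hc ▸ hi)
    have h2 : j ≠ x := fun hc => hx (hc ▸ hj)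
    simp [h, h1, h2]
  have hmem : ∀ i ∈ insert x p.u, i ≠ x → i ∈ p.u := fun i hi hne =>
    (Finset.mem_insert.1 hi).resolve_left hne
  let q : Cond D :=
    { u := insert x p.u
      n := p.n + 1
      N := p.N + 1
      η := η
      h := h
      sep := fun i hi j hj hij => by
        have h1 : decide (i = x) = decide (j = x) := by
          simpa [η] using hij p.n (Nat.lt_succ_self _)
        have h1 : i = x ↔ j = x := by simpa using h1
        by_cases hix : i = x
        · rw [hix, h1.1 hix]
        · exact p.sep _ (hmem i hi hix) _ (hmem j hj fun hc => hix (h1.2 hc))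
            ((hη i).symm.trans ((hij.mono (Nat.le_succ _)).trans (hη j)))
      h_lt := fun i hi j hj hij => by
        by_cases hc : i = x ∨ j = x
        · simp [h, hc]
        · push Not at hc
          have h1 := hmem i hi hc.1
          have h2 := hmem j hj hc.2
          rw [hh i h1 j h2 hij]
          exact (p.h_lt i h1 j h2 hij).trans (Nat.lt_succ_self _)
      h_symm := fun i j => by simp only [h, or_comm, p.h_symm i j] }
  refine ⟨q, T.le (Finset.subset_insert _ _) (Nat.le_succ _) (Nat.le_succ _) (fun i _ => hη i)
    (fun i _ => hη i) hh hh fun i hi j hj hij hlt => Or.inl ?_, Finset.mem_insert_self _ _⟩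
  by_cases hc : i = x ∨ j = x
  · simp [q, h, hc] at hlt
  · push Not at hc
    exact ⟨hmem i hi hc.1, hmem j hj hc.2⟩

theorem exists_le_length (p : Cond D) (l : ℕ) : ∃ q, p ≤ q ∧ l ≤ q.n ∧ l ≤ q.N := by
  obtain ⟨c, e, -, T⟩ := exists_twins_self p
  let q : Cond D :=
    { p with
      n := p.n + l
      N := p.N + l
      sep := fun i hi j hj hij => p.sep i hi j hj (hij.mono (Nat.le_add_right _ _))
      h_lt := fun i hi j hj hij => (p.h_lt i hi j hj hij).trans_le (Nat.le_add_right _ _) }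
  exact ⟨q, T.le (Finset.Subset.refl _) (Nat.le_add_right _ _) (Nat.le_add_right _ _)
    (fun _ _ => Agree.rfl) (fun _ _ => Agree.rfl) (fun _ _ _ _ _ => rfl) (fun _ _ _ _ _ => rfl)
    fun _ hi _ hj _ _ => Or.inl ⟨hi, hj⟩, Nat.le_add_left _ _, Nat.le_add_left _ _⟩

theorem exists_separating {M : Type} (g : M → ℕ → Bool) (hg : Function.Injective g)
    (u : Finset M) : ∃ l, ∀ i ∈ u, ∀ j ∈ u, Agree l (g i) (g j) → i = j := by
  have h : ∀ i j, ∃ l, Agree l (g i) (g j) → i = j := fun i j => by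
    by_cases hij : i = j
    · exact ⟨0, fun _ => hij⟩
    · obtain ⟨l, hl⟩ := Function.ne_iff.1 (hg.ne hij)
      exact ⟨l + 1, fun h => (hl (h l (Nat.lt_succ_self _))).elim⟩
  choose l hl using h
  refine ⟨u.sup fun i => u.sup (l i), fun i hi j hj hij => hl i j (hij.mono ?_)⟩
  exact (Finset.le_sup (f := l i) hj).trans (Finset.le_sup (f := fun i => u.sup (l i)) hi)

/-- The finite information on a condition that determines its compatibility type. -/
abbrev Code : Type := Σ (c l n : ℕ), ℕ × (Fin c → Fin l → Bool) × (Fin c → Fin n → Bool) ×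
  (Fin c → Fin c → ℕ) × (∀ r : Fin c, (Fin (r + 2) → Fin c) → ℕ)

/-- `x` codes `p` relative to the reals `g`. -/
def IsCode (g : M → ℕ → Bool) (p : Cond D) (x : Code) : Prop :=
  ∃ e : Fin x.1 → M, Function.Injective e ∧ (∀ i, e i ∈ p.u) ∧ (∀ y ∈ p.u, ∃ i, e i = y) ∧
    (∀ i ∈ p.u, ∀ j ∈ p.u, Agree x.2.1 (g i) (g j) → i = j) ∧ p.n = x.2.2.1 ∧
    p.N = x.2.2.2.1 ∧ (∀ i l, g (e i) l.1 = x.2.2.2.2.1 i l) ∧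
    (∀ i l, p.η (e i) l.1 = x.2.2.2.2.2.1 i l) ∧
    (∀ i j, p.h (e i) (e j) = x.2.2.2.2.2.2.1 i j) ∧
    ∀ (r : Fin x.1) (t : Fin (r + 2) → Fin x.1), D (r + 1) (e ∘ t) = x.2.2.2.2.2.2.2 r t

theorem exists_isCode {g : M → ℕ → Bool} (hg : Function.Injective g) (p : Cond D) :
    ∃ x, IsCode g p x := by
  obtain ⟨c, e, he, T⟩ := exists_twins_self p
  obtain ⟨l, hl⟩ := exists_separating g hg p.u
  exact ⟨⟨c, l, p.n, p.N, fun i m => g (e i) m, fun i m => p.η (e i) m,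
    fun i j => p.h (e i) (e j), fun r t => D (r + 1) (e ∘ t)⟩, e, he, T.mem, T.surj, hl, rfl, rfl,
    fun _ _ => rfl, fun _ _ => rfl, fun _ _ => rfl, fun _ _ => rfl⟩

theorem IsCode.compatible {g : M → ℕ → Bool} {p q : Cond D} {x : Code} (hp : IsCode g p x)
    (hq : IsCode g q x) : Compatible p q := by
  obtain ⟨c, l, n, N, s, t, h, d⟩ := x
  obtain ⟨e, he, hem, hes, hl, hn, hN, hs, ht, hh, hd⟩ := hp
  obtain ⟨e', he', hem', hes', hl', hn', hN', hs', ht', hh', hd'⟩ := hq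
  refine Twins.compatible (e := e) (e' := e') ⟨hn.trans hn'.symm, hN.trans hN'.symm, hem, hem',
    hes, hes', fun i m hm => ?_, fun i j _ => (hh i j).trans (hh' i j).symm,
    fun r a ha => ?_, fun i j hij => ?_⟩
  · rw [hn] at hm
    exact (ht i ⟨m, hm⟩).trans (ht' i ⟨m, hm⟩).symm
  · have hr : r < c := by
      have := Fintype.card_le_of_injective a ha
      simp only [Fintype.card_fin] at this
      omega
    exact (hd ⟨r, hr⟩ a).trans (hd' ⟨r, hr⟩ a).symm
  -- A common index shows the same digits of `g` at both of its positions; digits up to `l` separate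
  -- `p.u`, so the positions coincide.
  · refine he (hl _ (hem i) _ (hem j) fun m hm => ?_)
    rw [hs j ⟨m, hm⟩, ← hs' j ⟨m, hm⟩, hij]

/-- There are countably many codes, and conditions with a common code are compatible. Codes use
distinct reals attached to the indices, whence the bound by `𝔠`. -/
theorem ccc (hM : #M ≤ 𝔠) : CCC (Cond D) := by
  obtain ⟨g⟩ : Nonempty (M ↪ (ℕ → Bool)) := by
    rw [← Cardinal.le_def]
    refine hM.trans_eq ?_
    simp
  choose x hx using exists_isCode (D := D) g.injective
  intro A hA
  have : Function.Injective fun p : A => x p := fun p q hpq => by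
    by_contra hne
    refine hA p.2 q.2 (fun h => hne (Subtype.ext h)) ((hx p).compatible (x := x p) ?_)
    have hpq : x p = x q := hpq
    rw [hpq]
    exact hx q
  exact this.countable

instance : Nonempty (Cond D) :=
  ⟨⟨∅, 0, 0, fun _ _ => false, fun _ _ => 0, fun _ h => by simp at h, fun _ h => by simp at h,
    fun _ _ => rfl⟩⟩

theorem exists_generic (hMA : MartinsAxiom) (hM : #M < 𝔠) : ∃ G : Order.Ideal (Cond D),
    (∀ x, ∃ p ∈ G, x ∈ p.u) ∧ ∀ l, ∃ p ∈ G, l ≤ p.n ∧ l ≤ p.N := by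
  let F : Set (Set (Cond D)) := Set.range (fun x : M => {p : Cond D | x ∈ p.u}) ∪
    Set.range fun l : ℕ => {p : Cond D | l ≤ p.n ∧ l ≤ p.N}
  have h1 : #F < 𝔠 := by
    refine (Cardinal.mk_union_le _ _).trans_lt (Cardinal.add_lt_of_lt Cardinal.aleph0_le_continuum
      (Cardinal.mk_range_le.trans_lt hM) (Cardinal.mk_range_le.trans_lt ?_))
    simpa using Cardinal.aleph0_lt_continuum
  have h2 : ∀ d ∈ F, IsCofinal d := by
    rintro _ (⟨x, rfl⟩ | ⟨l, rfl⟩) p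
    · obtain ⟨q, h1, h2⟩ := exists_le_mem p x
      exact ⟨q, h2, h1⟩
    · obtain ⟨q, h1, h2⟩ := exists_le_length p l
      exact ⟨q, h2, h1⟩
  obtain ⟨G, hG⟩ := hMA (Cond D) (ccc hM.le) F h1 h2
  refine ⟨G, fun x => ?_, fun l => ?_⟩
  · obtain ⟨p, hp, hx⟩ := hG _ (Or.inl ⟨x, rfl⟩)
    exact ⟨p, hp, hx⟩
  · obtain ⟨p, hp, hx⟩ := hG _ (Or.inr ⟨l, rfl⟩)
    exact ⟨p, hp, hx⟩

end Cond

/-! ### The Borel set of a generic filter and its lack of perfect squares. -/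

theorem isOpen_agree (n : ℕ) (y : Reals) : IsOpen {z : Reals | Agree n z y} := by
  have : {z : Reals | Agree n z y} = ⋂ l ∈ Set.Iio n, {z | z l = y l} := by
    ext z; simp [Agree]
  rw [this]
  exact (Set.finite_Iio n).isOpen_biInter fun l _ =>
    (isOpen_discrete ({y l} : Set Bool)).preimage (continuous_apply (A := fun _ => Bool) l)

theorem isClosed_agree (n : ℕ) (y : Reals) : IsClosed {z : Reals | Agree n z y} := by
  have : {z : Reals | Agree n z y} = ⋂ l ∈ Set.Iio n, {z | z l = y l} := by
    ext z; simp [Agree]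
  rw [this]
  exact isClosed_biInter fun l _ => isClosed_eq (continuous_apply l) continuous_const

theorem exists_agree_subset {U : Set Reals} (hU : IsOpen U) {y : Reals} (hy : y ∈ U) :
    ∃ n, ∀ z, Agree n z y → z ∈ U := by
  obtain ⟨I, u, hu, hI⟩ := isOpen_pi_iff.1 hU y hy
  refine ⟨I.sup id + 1, fun z hz => hI fun l hl => ?_⟩
  rw [hz l (Nat.lt_succ_of_le (Finset.le_sup (f := id) hl))]
  exact (hu l hl).2

theorem exists_agree_prod_subset {U : Set (Reals × Reals)} (hU : IsOpen U) {y : Reals × Reals}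
    (hy : y ∈ U) : ∃ n, ∀ z : Reals × Reals, Agree n z.1 y.1 → Agree n z.2 y.2 → z ∈ U := by
  obtain ⟨V, W, hV, hW, h1, h2, hVW⟩ := isOpen_prod_iff.1 hU y.1 y.2 hy
  obtain ⟨n, hn⟩ := exists_agree_subset hV h1
  obtain ⟨m, hm⟩ := exists_agree_subset hW h2
  exact ⟨max n m, fun z hz1 hz2 => hVW ⟨hn _ (hz1.mono (le_max_left _ _)),
    hm _ (hz2.mono (le_max_right _ _))⟩⟩

theorem eq_of_forall_agree {x y : Reals} (h : ∀ n, Agree n x y) : x = y :=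
  funext fun l => h (l + 1) l (Nat.lt_succ_self l)

/-- If the square of a perfect set is covered off the diagonal by countably many closed sets, then
below each point there are two disjoint pieces whose product lies in one of the closed sets. -/
theorem exists_split {P : Set Reals} (hP : Perfect P) {F : ℕ → Set (Reals × Reals)}
    (hF : ∀ m, IsClosed (F m)) (hcov : ∀ x ∈ P, ∀ y ∈ P, x ≠ y → ∃ m, (x, y) ∈ F m)
    {y : Reals} (hy : y ∈ P) (n : ℕ) :
    ∃ y₀ ∈ P, ∃ y₁ ∈ P, ∃ n' ≥ n, ∃ m, Agree n y₀ y ∧ Agree n y₁ y ∧ ¬ Agree n' y₀ y₁ ∧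
      ∀ z₀ ∈ P, ∀ z₁ ∈ P, Agree n' z₀ y₀ → Agree n' z₁ y₁ → (z₀, z₁) ∈ F m := by
  obtain ⟨y', ⟨hy'n, hy'P⟩, hne⟩ := accPt_iff_nhds.1 (hP.acc y hy) _
    ((isOpen_agree n y).mem_nhds (show Agree n y y from Agree.rfl))
  obtain ⟨l₀, hl₀⟩ : ∃ l, ¬ Agree l y y' := by
    by_contra! hc
    exact hne (eq_of_forall_agree hc).symm
  set l := max l₀ n with hl
  have hsep : ¬ Agree l y y' := fun h => hl₀ (h.mono (le_max_left _ _))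
  let K : Set (Reals × Reals) := (P ∩ {z | Agree l z y}) ×ˢ (P ∩ {z | Agree l z y'})
  have hK : IsClosed K := (hP.closed.inter (isClosed_agree _ _)).prod
    (hP.closed.inter (isClosed_agree _ _))
  have : CompactSpace K := isCompact_iff_compactSpace.1 hK.isCompact
  have : Nonempty K := ⟨⟨(y, y'), ⟨hy, Agree.rfl⟩, ⟨hy'P, Agree.rfl⟩⟩⟩
  have hdiff : ∀ z ∈ K, z.1 ≠ z.2 := fun z hz h =>
    hsep (hz.1.2.symm.trans (h ▸ hz.2.2))
  -- Baire category in the compact box `K`, which misses the diagonal.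
  obtain ⟨m, ⟨⟨x, hx⟩, hxm⟩⟩ := nonempty_interior_of_iUnion_of_closed
    (f := fun m => (Subtype.val ⁻¹' F m : Set K)) (fun m => (hF m).preimage continuous_subtype_val)
    (by
      refine Set.eq_univ_of_forall fun z => ?_
      obtain ⟨m, hm⟩ := hcov z.1.1 z.2.1.1 z.1.2 z.2.2.1 (hdiff _ z.2)
      exact Set.mem_iUnion.2 ⟨m, hm⟩)
  obtain ⟨V, hV, hVo, hxV⟩ := mem_interior.1 hxm
  obtain ⟨U, hU, rfl⟩ := isOpen_induced_iff.1 hVo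
  obtain ⟨n₁, hn₁⟩ := exists_agree_prod_subset hU hxV
  refine ⟨x.1, hx.1.1, x.2, hx.2.1, max n₁ l, (le_max_right _ _).trans (le_max_right _ _), m,
    hx.1.2.mono (le_max_right _ _), (hx.2.2.mono (le_max_right _ _)).trans hy'n, ?_, ?_⟩
  · exact fun h => hsep (hx.1.2.symm.trans ((h.mono (le_max_right _ _)).trans hx.2.2))
  · intro z₀ hz₀ z₁ hz₁ h₀ h₁
    have hzK : (z₀, z₁) ∈ K := ⟨⟨hz₀, (h₀.mono (le_max_right _ _)).trans hx.1.2⟩,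
      ⟨hz₁, (h₁.mono (le_max_right _ _)).trans hx.2.2⟩⟩
    exact hV (show (⟨(z₀, z₁), hzK⟩ : K) ∈ _ from
      hn₁ (z₀, z₁) (h₀.mono (le_max_left _ _)) (h₁.mono (le_max_left _ _)))

namespace Cond

variable {M : Type} {D : ∀ r : ℕ, (Fin (r + 1) → M) → ℕ}

/-- The `m`-th closed set read off from a generic filter. -/
def closedPart (G : Order.Ideal (Cond D)) (m : ℕ) : Set (Reals × Reals) :=
  {z | ∀ p ∈ G, m < p.N → ∃ i ∈ p.u, ∃ j ∈ p.u, i ≠ j ∧ Agree p.n z.1 (p.η i) ∧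
    Agree p.n z.2 (p.η j) ∧ p.h i j = m}

theorem isClosed_closedPart (G : Order.Ideal (Cond D)) (m : ℕ) : IsClosed (closedPart G m) := by
  have : closedPart G m = ⋂ p ∈ G, ⋂ (_ : m < p.N), ⋃ i ∈ p.u, ⋃ j ∈ p.u,
      {z : Reals × Reals | (i ≠ j ∧ p.h i j = m) ∧ Agree p.n z.1 (p.η i) ∧
        Agree p.n z.2 (p.η j)} := by
    ext z
    simp only [closedPart, Set.mem_ofPred_eq, Set.mem_iInter, Set.mem_iUnion, exists_prop]
    refine forall₃_congr fun p _ _ => exists_congr fun i => and_congr_right fun _ =>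
      exists_congr fun j => and_congr_right fun _ => ?_
    tauto
  rw [this]
  refine isClosed_biInter fun p _ => isClosed_iInter fun _ =>
    p.u.finite_toSet.isClosed_biUnion fun i _ => p.u.finite_toSet.isClosed_biUnion fun j _ => ?_
  exact isClosed_const.and (((isClosed_agree _ _).preimage continuous_fst).and
    ((isClosed_agree _ _).preimage continuous_snd))

theorem closedPart_symm {G : Order.Ideal (Cond D)} {m : ℕ} {x y : Reals}
    (h : (x, y) ∈ closedPart G m) : (y, x) ∈ closedPart G m := by
  intro p hp hm
  obtain ⟨i, hi, j, hj, hij, h1, h2, h3⟩ := h p hp hm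
  exact ⟨j, hj, i, hi, hij.symm, h2, h1, (p.h_symm j i).trans h3⟩

/-- The Borel set read off from a generic filter. -/
def genericSet (G : Order.Ideal (Cond D)) : Set (Reals × Reals) :=
  Set.diagonal Reals ∪ ⋃ m, closedPart G m

theorem isBorel_genericSet (G : Order.Ideal (Cond D)) : IsBorel (genericSet G) := by
  let _ : MeasurableSpace (Reals × Reals) := borel _
  have : BorelSpace (Reals × Reals) := ⟨rfl⟩
  exact isClosed_diagonal.measurableSet.union
    (MeasurableSet.iUnion fun m => (isClosed_closedPart G m).measurableSet)

/-- The initial segments in the filter cohere to a real for each index. Distinct indices have a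
fixed colour, and the `pairs` clause puts their reals into the closed set of that colour. -/
theorem containsSquare_genericSet (G : Order.Ideal (Cond D)) (hG : ∀ x, ∃ p ∈ G, x ∈ p.u)
    (hG' : ∀ l, ∃ p ∈ G, l ≤ p.n ∧ l ≤ p.N) : ContainsSquare (genericSet G) #M := by
  have hdir : ∀ p ∈ G, ∀ q ∈ G, ∃ s ∈ G, p ≤ s ∧ q ≤ s := fun p hp q hq =>
    G.directed p hp q hq
  have hex : ∀ (x : M) (l : ℕ), ∃ p ∈ G, x ∈ p.u ∧ l < p.n := fun x l => by
    obtain ⟨p, hp, hx⟩ := hG x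
    obtain ⟨q, hq, hl, -⟩ := hG' (l + 1)
    obtain ⟨s, hs, hps, hqs⟩ := hdir p hp q hq
    exact ⟨s, hs, hps.u hx, lt_of_lt_of_le hl hqs.n⟩
  choose f hfG hfu hfn using hex
  let g : M → Reals := fun x l => (f x l).η x l
  have hg : ∀ p ∈ G, ∀ x ∈ p.u, Agree p.n (g x) (p.η x) := fun p hp x hx l hl => by
    obtain ⟨s, hs, hps, hfs⟩ := hdir p hp _ (hfG x l)
    rw [← hps.η x hx l hl]
    exact (hfs.η x (hfu x l) l (hfn x l)).symm
  have hpair : ∀ x y, ∃ p ∈ G, x ∈ p.u ∧ y ∈ p.u := fun x y => by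
    obtain ⟨p, hp, hx⟩ := hG x
    obtain ⟨q, hq, hy⟩ := hG y
    obtain ⟨s, hs, hps, hqs⟩ := hdir p hp q hq
    exact ⟨s, hs, hps.u hx, hqs.u hy⟩
  have hgi : Function.Injective g := fun x y hxy => by
    obtain ⟨p, hp, hx, hy⟩ := hpair x y
    exact p.sep x hx y hy ((hg p hp x hx).symm.trans (hxy ▸ hg p hp y hy))
  refine ⟨Set.range g, Cardinal.mk_range_eq g hgi, ?_⟩
  rintro ⟨_, _⟩ ⟨⟨x, rfl⟩, ⟨y, rfl⟩⟩
  by_cases hxy : x = y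
  · exact Or.inl (by simp [hxy])
  obtain ⟨p₀, hp₀, hx, hy⟩ := hpair x y
  refine Or.inr (Set.mem_iUnion.2 ⟨p₀.h x y, fun p hp hlt => ?_⟩)
  obtain ⟨q, hq, h0q, hpq⟩ := hdir p₀ hp₀ p hp
  have hh : q.h x y = p₀.h x y := h0q.h x hx y hy hxy
  obtain ⟨i, hi, j, hj, hij, h1, h2, h3⟩ := hpq.pairs x (h0q.u hx) y (h0q.u hy) hxy (hh ▸ hlt)
  exact ⟨i, hi, j, hj, hij, ((hg q hq x (h0q.u hx)).mono hpq.n).trans h1,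
    ((hg q hq y (h0q.u hy)).mono hpq.n).trans h2, h3.trans hh⟩

/-- A tuple of points of the generic set with given colours is matched by a tuple of indices. -/
theorem exists_realization {G : Order.Ideal (Cond D)} {p : Cond D} (hp : p ∈ G) {r : ℕ}
    (z : Fin (r + 2) → Reals) (c : Fin (r + 2) → Fin (r + 2) → ℕ)
    (hc : ∀ i j, i ≠ j → c i j < p.N)
    (hz : ∀ i j, i ≠ j → (z i, z j) ∈ closedPart G (c i j)) :
    ∃ a : Fin (r + 2) → M, (∀ i, a i ∈ p.u) ∧ (∀ i, Agree p.n (z i) (p.η (a i))) ∧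
      ∀ i j, i ≠ j → p.h (a i) (a j) = c i j := by
  have h : ∀ i, ∃ x ∈ p.u, Agree p.n (z i) (p.η x) := fun i => by
    obtain ⟨j, hj⟩ := exists_ne i
    obtain ⟨x, hx, _, _, _, h1, _⟩ := hz i j hj.symm p hp (hc i j hj.symm)
    exact ⟨x, hx, h1⟩
  choose a ha hza using h
  refine ⟨a, ha, hza, fun i j hij => ?_⟩
  obtain ⟨x, hx, y, hy, _, h1, h2, h3⟩ := hz i j hij p hp (hc i j hij)
  rw [p.sep _ (ha i) _ hx ((hza i).symm.trans h1), p.sep _ (ha j) _ hy ((hza j).symm.trans h2), h3]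

/-- The neighbourhoods given by the tuple `a` meet `P`, and pairs of points of `P` from them have
the colours of the pairs in `a`. -/
structure Solid (G : Order.Ideal (Cond D)) (P : Set Reals) (p : Cond D) {r : ℕ}
    (a : Fin (r + 2) → M) : Prop where
  mem : p ∈ G
  u : ∀ i, a i ∈ p.u
  inj : Function.Injective a
  nonempty : ∀ i, ∃ y ∈ P, Agree p.n y (p.η (a i))
  pairs : ∀ i j, i ≠ j → ∀ y ∈ P, ∀ z ∈ P, Agree p.n y (p.η (a i)) → Agree p.n z (p.η (a j)) →
    (y, z) ∈ closedPart G (p.h (a i) (a j))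

theorem exists_large {G : Order.Ideal (Cond D)} (hG' : ∀ l, ∃ p ∈ G, l ≤ p.n ∧ l ≤ p.N)
    {p : Cond D} (hp : p ∈ G) (n m : ℕ) : ∃ q ∈ G, p ≤ q ∧ n ≤ q.n ∧ m < q.N := by
  obtain ⟨q, hq, h1, h2⟩ := hG' (max n (m + 1))
  obtain ⟨s, hs, hps, hqs⟩ := G.directed p hp q hq
  exact ⟨s, hs, hps, (le_max_left _ _).trans (h1.trans hqs.n),
    ((le_max_right _ _).trans h2).trans hqs.N⟩

/-- `exists_split` gives two separated neighbourhoods whose pairs share a colour `m`; a condition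
with enough digits and more than `m` colours realizes them. -/
theorem exists_solid {G : Order.Ideal (Cond D)} (hG' : ∀ l, ∃ p ∈ G, l ≤ p.n ∧ l ≤ p.N)
    {P : Set Reals} (hP : Perfect P) (hne : P.Nonempty)
    (hcov : ∀ x ∈ P, ∀ y ∈ P, x ≠ y → ∃ m, (x, y) ∈ closedPart G m) :
    ∃ (p : Cond D) (a : Fin (0 + 2) → M), Solid G P p a := by
  obtain ⟨y, hy⟩ := hne
  obtain ⟨y₀, hy₀, y₁, hy₁, n', -, m, -, -, hsep, hF⟩ :=
    exists_split hP (isClosed_closedPart G) hcov hy 0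
  obtain ⟨p₀, hp₀⟩ := G.nonempty
  obtain ⟨p, hp, -, hn, hm⟩ := exists_large hG' hp₀ n' m
  have hFz : ∀ i j : Fin (0 + 2), i ≠ j → ∀ w ∈ P, ∀ w' ∈ P,
      Agree n' w ((![y₀, y₁] : Fin (0 + 2) → Reals) i) →
      Agree n' w' ((![y₀, y₁] : Fin (0 + 2) → Reals) j) → (w, w') ∈ closedPart G m := by
    intro i j hij w hw w' hw' h1 h2
    fin_cases i <;> fin_cases j
    · exact (hij rfl).elim
    · exact hF w hw w' hw' h1 h2
    · exact closedPart_symm (hF w' hw' w hw h2 h1)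
    · exact (hij rfl).elim
  have hzP : ∀ i, (![y₀, y₁] : Fin (0 + 2) → Reals) i ∈ P := by
    intro i
    fin_cases i
    · exact hy₀
    · exact hy₁
  obtain ⟨a, ha, hza, hc⟩ := exists_realization hp (![y₀, y₁] : Fin (0 + 2) → Reals)
    (fun _ _ => m) (fun _ _ _ => hm)
    fun i j hij => hFz i j hij _ (hzP i) _ (hzP j) Agree.rfl Agree.rfl
  refine ⟨p, a, hp, ha, ?_, fun i => ⟨_, hzP i, hza i⟩, fun i j hij w hw w' hw' h1 h2 => ?_⟩
  · have h01 : a 0 ≠ a 1 := fun h => hsep <| by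
      have h0 := hza 0
      have h1 := hza 1
      rw [h] at h0
      exact (h0.trans h1.symm).mono hn
    intro i j hij
    fin_cases i <;> fin_cases j
    · rfl
    · exact (h01 hij).elim
    · exact (h01 hij.symm).elim
    · rfl
  · rw [hc i j hij]
    exact hFz i j hij w hw w' hw' ((h1.trans (hza i).symm).mono hn)
      ((h2.trans (hza j).symm).mono hn)

/-- Split `P` inside the `k`-th neighbourhood and realize the enlarged tuple of points in a longer
condition. Whichever half serves as the `k`-th point, the realization resembles `a` over `p`, so the
`tuples` clause preserves the value of `D`. -/
theorem Solid.exists_extension {G : Order.Ideal (Cond D)}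
    (hG' : ∀ l, ∃ p ∈ G, l ≤ p.n ∧ l ≤ p.N) {P : Set Reals} (hP : Perfect P)
    (hcov : ∀ x ∈ P, ∀ y ∈ P, x ≠ y → ∃ m, (x, y) ∈ closedPart G m) {p : Cond D} {r : ℕ}
    {a : Fin (r + 2) → M} (S : Solid G P p a) (k : Fin (r + 2)) :
    ∃ (q : Cond D) (b : Fin (r + 2) → M) (x : M), Solid G P q (Fin.snoc b x : Fin (r + 3) → M) ∧
      D (r + 1) b = D (r + 1) a ∧ D (r + 1) (Function.update b k x) = D (r + 1) a := by
  choose y hyP hya using S.nonempty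
  obtain ⟨y₀, hy₀, y₁, hy₁, n', hn', m, hy₀y, hy₁y, hsep, hF⟩ :=
    exists_split hP (isClosed_closedPart G) hcov (hyP k) p.n
  obtain ⟨q, hq, hpq, hnq, hmq⟩ := exists_large hG' S.mem n' m
  let z : Fin (r + 3) → Reals := Fin.snoc (Function.update y k y₀ : Fin (r + 2) → Reals) y₁
  -- The index of `p` below each new point. Only the two halves share one, and their pair receives
  -- the colour `m` from the splitting.
  let aa : Fin (r + 3) → M := Fin.snoc a (a k)
  let c : Fin (r + 3) → Fin (r + 3) → ℕ := fun i j =>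
    open Classical in if aa i = aa j then m else p.h (aa i) (aa j)
  have hzl : z (Fin.last _) = y₁ := Fin.snoc_last ..
  have hzk : z k.castSucc = y₀ := by
    simp only [z, Fin.snoc_castSucc, Function.update_self]
  have hzi : ∀ i, i ≠ k → z i.castSucc = y i := fun i hi => by
    simp only [z, Fin.snoc_castSucc, Function.update_of_ne hi]
  have haau : ∀ i, aa i ∈ p.u := fun i => by
    refine Fin.lastCases ?_ (fun i => ?_) i
    · simpa [aa] using S.u k
    · simpa [aa] using S.u i
  have hzP : ∀ i, z i ∈ P := fun i => by
    refine Fin.lastCases ?_ (fun i => ?_) i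
    · rwa [hzl]
    · by_cases hi : i = k
      · rwa [hi, hzk]
      · rw [hzi i hi]; exact hyP i
  have hzaa : ∀ i, Agree p.n (z i) (p.η (aa i)) := fun i => by
    refine Fin.lastCases ?_ (fun i => ?_) i
    · simpa [hzl, aa] using hy₁y.trans (hya k)
    · by_cases hi : i = k
      · subst hi; simpa [hzk, aa] using hy₀y.trans (hya i)
      · simpa [hzi i hi, aa] using hya i
  have hcase : ∀ i j, i ≠ j → aa i = aa j →
      (z i = y₀ ∧ z j = y₁) ∨ (z i = y₁ ∧ z j = y₀) := by
    intro i
    refine Fin.lastCases ?_ (fun i => ?_) i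
    · intro j
      refine Fin.lastCases ?_ (fun j => ?_) j
      · exact fun h => (h rfl).elim
      · intro _ h
        have : k = j := S.inj (by simpa [aa] using h)
        subst this
        exact Or.inr ⟨hzl, hzk⟩
    · intro j
      refine Fin.lastCases ?_ (fun j => ?_) j
      · intro _ h
        have : i = k := S.inj (by simpa [aa] using h)
        subst this
        exact Or.inl ⟨hzk, hzl⟩
      · intro hij h
        have : i = j := S.inj (by simpa [aa] using h)
        exact (hij (this ▸ rfl)).elim
  have hex : ∀ i, ∃ i', aa i = a i' := fun i => by
    refine Fin.lastCases ?_ (fun i => ?_) i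
    · exact ⟨k, by simp [aa]⟩
    · exact ⟨i, by simp [aa]⟩
  have hFz : ∀ i j, i ≠ j → ∀ w ∈ P, ∀ w' ∈ P, Agree q.n w (z i) → Agree q.n w' (z j) →
      (w, w') ∈ closedPart G (c i j) := by
    intro i j hij w hw w' hw' h1 h2
    by_cases hc : aa i = aa j
    · simp only [c, if_pos hc]
      rcases hcase i j hij hc with ⟨e1, e2⟩ | ⟨e1, e2⟩
      · rw [e1] at h1; rw [e2] at h2
        exact hF w hw w' hw' (h1.mono hnq) (h2.mono hnq)
      · rw [e1] at h1; rw [e2] at h2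
        exact closedPart_symm (hF w' hw' w hw (h2.mono hnq) (h1.mono hnq))
    · simp only [c, if_neg hc]
      have g1 := (h1.mono hpq.n).trans (hzaa i)
      have g2 := (h2.mono hpq.n).trans (hzaa j)
      obtain ⟨i', hi'⟩ := hex i
      obtain ⟨j', hj'⟩ := hex j
      rw [hi'] at hc g1 ⊢
      rw [hj'] at hc g2 ⊢
      exact S.pairs i' j' (fun h => hc (h ▸ rfl)) w hw w' hw' g1 g2
  have hclt : ∀ i j, i ≠ j → c i j < q.N := fun i j _ => by
    by_cases hc : aa i = aa j
    · simpa only [c, if_pos hc] using hmq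
    · simpa only [c, if_neg hc] using (p.h_lt _ (haau i) _ (haau j) hc).trans_le hpq.N
  obtain ⟨a', ha', hza', hc'⟩ := exists_realization (r := r + 1) hq z c hclt
    fun i j hij => hFz i j hij _ (hzP i) _ (hzP j) Agree.rfl Agree.rfl
  have hSolid : Solid G P q a' := by
    refine ⟨hq, ha', fun i j hij => ?_, fun i => ⟨_, hzP i, hza' i⟩,
      fun i j hij w hw w' hw' h1 h2 => ?_⟩
    · by_contra hne
      have hz : Agree q.n (z i) (z j) := (hza' i).trans (hij ▸ (hza' j).symm)
      by_cases hc : aa i = aa j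
      · rcases hcase i j hne hc with ⟨e1, e2⟩ | ⟨e1, e2⟩
        · rw [e1, e2] at hz
          exact hsep (hz.mono hnq)
        · rw [e1, e2] at hz
          exact hsep (hz.symm.mono hnq)
      · exact hc (p.sep _ (haau i) _ (haau j)
          ((hzaa i).symm.trans ((hz.mono hpq.n).trans (hzaa j))))
    · rw [hc' i j hij]
      exact hFz i j hij w hw w' hw' (h1.trans (hza' i).symm) (h2.trans (hza' j).symm)
  have hD : ∀ ι : Fin (r + 2) → Fin (r + 3), (∀ i, aa (ι i) = a i) →
      D (r + 1) (a' ∘ ι) = D (r + 1) a := by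
    intro ι hι
    refine hpq.tuples r _ a (fun i => ha' _) S.u S.inj (fun i => ?_) fun i j hij => ?_
    · have h1 := ((hza' (ι i)).mono hpq.n).symm.trans (hzaa (ι i))
      rwa [hι] at h1
    · have h1 : aa (ι i) ≠ aa (ι j) := by
        rw [hι, hι]; exact S.inj.ne hij
      have h2 : ι i ≠ ι j := fun h => h1 (h ▸ rfl)
      change q.h (a' (ι i)) (a' (ι j)) = _
      rw [hc' _ _ h2]
      simp only [c, if_neg h1]
      rw [hι, hι]
  refine ⟨q, a' ∘ Fin.castSucc, a' (Fin.last _), ?_, hD _ fun i => by simp [aa], ?_⟩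
  · have : (Fin.snoc (a' ∘ Fin.castSucc) (a' (Fin.last _)) : Fin (r + 3) → M) = a' :=
      Fin.snoc_init_self a'
    rwa [this]
  · rw [← Function.comp_update]
    refine hD _ fun i => ?_
    by_cases hi : i = k
    · subst hi; simp [aa]
    · simp [aa, Function.update_of_ne hi]

/-- Extending a solid tuple at the coordinate prescribed by its colour yields another solid tuple
with a smaller ordinal. -/
theorem not_containsPerfectSquare_genericSet {G : Order.Ideal (Cond D)}
    (hG' : ∀ l, ∃ p ∈ G, l ≤ p.n ∧ l ≤ p.N) {k : ∀ r : ℕ, ℕ → Fin (r + 1)}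
    {β : ℕ → Ordinal.{0}} (H : ∀ (r : ℕ) (a : Fin (r + 1) → M) (b : M), Function.Injective a →
      b ∉ Set.range a → D r (Function.update a (k r (D r a)) b) = D r a →
      β (D (r + 1) (Fin.snoc a b)) < β (D r a)) :
    ¬ ContainsPerfectSquare (genericSet G) := by
  rintro ⟨P, hP, hne, hPG⟩
  have hcov : ∀ x ∈ P, ∀ y ∈ P, x ≠ y → ∃ m, (x, y) ∈ closedPart G m := by
    intro x hx y hy hxy
    rcases hPG (Set.mk_mem_prod hx hy) with h | h
    · exact (hxy h).elim
    · exact Set.mem_iUnion.1 h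
  have key : ∀ (γ : Ordinal.{0}) (r : ℕ) (p : Cond D) (a : Fin (r + 2) → M), Solid G P p a →
      β (D (r + 1) a) = γ → False := by
    intro γ
    induction γ using WellFoundedLT.induction with
    | _ γ ih =>
      intro r p a S hγ
      obtain ⟨q, b, x, S', h1, h2⟩ := S.exists_extension hG' hP hcov (k (r + 1) (D (r + 1) a))
      obtain ⟨hb, hx⟩ := Fin.snoc_injective_iff.1 S'.inj
      refine ih _ ?_ _ q _ S' rfl
      rw [← hγ, ← h1]
      exact H (r + 1) b x hb hx (by rw [h1]; exact h2)
  obtain ⟨p, a, S⟩ := exists_solid hG' hP hne hcov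
  exact key _ _ p a S rfl

end Cond

/-- Under Martin's axiom, a thin cardinal below the continuum is the size of a square in a Borel
set without perfect squares. -/
theorem exists_borel_of_thin (hMA : MartinsAxiom) {M : Type} (hT : Thin M) (hM : #M < 𝔠) :
    ∃ B : Set (Reals × Reals), IsBorel B ∧ ContainsSquare B #M ∧ ¬ ContainsPerfectSquare B := by
  obtain ⟨_, D, k, β, -, H⟩ := hT
  obtain ⟨G, hG, hG'⟩ := Cond.exists_generic (D := D) hMA hM
  exact ⟨Cond.genericSet G, Cond.isBorel_genericSet G, Cond.containsSquare_genericSet G hG hG',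
    Cond.not_containsPerfectSquare_genericSet hG' H⟩

/-! ### Fusion sequences and the perfect squares that they produce. -/

section Fusion

variable {A : Set Reals} (z : A → A → ℕ → ℕ)

/-- The tuples `a` and `b` agree up to `n`, and so do the witnesses of their pairs. -/
def Same (n : ℕ) {r : ℕ} (a b : Fin r → A) : Prop :=
  (∀ i, Agree n (a i) (b i)) ∧ ∀ i j, ∀ l < n, z (a i) (a j) l = z (b i) (b j) l

/-- A sequence of longer and longer tuples, in which the `j+1`-st arises from the `j`-th by
splitting the coordinate `k j`. -/
structure Fusion (r₀ : ℕ) (a : ∀ j, Fin (r₀ + j + 1) → A) (n : ℕ → ℕ)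
    (k : ∀ j, Fin (r₀ + j + 1)) : Prop where
  sep : ∀ j i i', Agree (n j) (a j i) (a j i') → i = i'
  mono : StrictMono n
  left : ∀ j, Same z (n j) (a (j + 1) ∘ Fin.castSucc) (a j)
  right : ∀ j, Same z (n j)
    (Function.update (a (j + 1) ∘ Fin.castSucc) (k j) (a (j + 1) (Fin.last _))) (a j)
  unbounded : ∀ i j, ∃ j' ≥ j, (k j' : ℕ) = i

variable {z} {r₀ : ℕ} {a : ∀ j, Fin (r₀ + j + 1) → A} {n : ℕ → ℕ} {k : ∀ j, Fin (r₀ + j + 1)}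

namespace Fusion

/-- The limit set of a fusion sequence. -/
def limit (a : ∀ j, Fin (r₀ + j + 1) → A) (n : ℕ → ℕ) : Set Reals :=
  {x | ∀ j, ∃ i, Agree (n j) x (a j i)}

theorem coherent (H : Fusion z r₀ a n k) {j j' : ℕ} (hj : j ≤ j') (i : ℕ)
    (h : i < r₀ + j + 1) (h' : i < r₀ + j' + 1) :
    Agree (n j) (a j' ⟨i, h'⟩) (a j ⟨i, h⟩) := by
  induction j', hj using Nat.le_induction with
  | base => exact Agree.rfl
  | succ j' hj ih =>
    have h1 : i < r₀ + j' + 1 := by omega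
    exact (((H.left j').1 ⟨i, h1⟩).mono (H.mono.monotone hj)).trans (ih h1)

theorem right_last (H : Fusion z r₀ a n k) (j : ℕ) :
    Agree (n j) (a (j + 1) (Fin.last _)) (a j (k j)) := by
  have := (H.right j).1 (k j)
  rwa [Function.update_self] at this

theorem descend (H : Fusion z r₀ a n k) {j j' : ℕ} (hj : j ≤ j') :
    ∀ i, ∃ i', Agree (n j) (a j' i) (a j i') := by
  induction j', hj using Nat.le_induction with
  | base => exact fun i => ⟨i, Agree.rfl⟩
  | succ j' hj ih =>
    intro i
    refine Fin.lastCases ?_ (fun i => ?_) i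
    · obtain ⟨i', hi'⟩ := ih (k j')
      exact ⟨i', ((H.right_last j').mono (H.mono.monotone hj)).trans hi'⟩
    · obtain ⟨i', hi'⟩ := ih i
      exact ⟨i', (((H.left j').1 i).mono (H.mono.monotone hj)).trans hi'⟩

/-- Following a fixed index `i` through the later tuples converges; stage `j + l + 1` decides digit
`l` because `n` is strictly increasing. -/
theorem exists_mem_limit (H : Fusion z r₀ a n k) (j : ℕ) (i : Fin (r₀ + j + 1)) :
    ∃ x ∈ limit a n, Agree (n j) x (a j i) := by
  let x : Reals := fun l => (a (j + l + 1) ⟨i, by omega⟩ : Reals) l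
  have hx : ∀ j₁ (h : j ≤ j₁), Agree (n j₁) x (a j₁ ⟨i, by omega⟩) := fun j₁ h l hl => by
    rcases le_total j₁ (j + l + 1) with h1 | h1
    · exact H.coherent h1 i _ _ l hl
    · exact (H.coherent h1 i _ _ l
        ((by omega : l < j + l + 1).trans_le (H.mono.le_apply))).symm
  refine ⟨x, fun j₁ => ?_, hx j le_rfl⟩
  rcases le_total j j₁ with h | h
  · exact ⟨_, hx j₁ h⟩
  · obtain ⟨i', hi'⟩ := H.descend h i
    exact ⟨i', ((hx j le_rfl).mono (H.mono.monotone h)).trans hi'⟩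

/-- No point is isolated: the index approximating it is split at a later stage, giving two distinct
limit points nearby, at least one of them new. -/
theorem perfect_limit (H : Fusion z r₀ a n k) : Perfect (limit a n) := by
  refine ⟨?_, fun x hx => ?_⟩
  · have : limit a n = ⋂ j, ⋃ i, {x : Reals | Agree (n j) x (a j i)} := by
      ext x; simp [limit]
    rw [this]
    exact isClosed_iInter fun j => isClosed_iUnion_of_finite fun i => isClosed_agree _ _
  · rw [accPt_iff_nhds]
    intro U hU
    obtain ⟨V, hVU, hV, hxV⟩ := mem_nhds_iff.1 hU
    obtain ⟨m, hm⟩ := exists_agree_subset hV hxV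
    obtain ⟨i, hi⟩ := hx m
    obtain ⟨j, hj, hk⟩ := H.unbounded i m
    have hmj : n m ≤ n j := H.mono.monotone hj
    have hik : k j = ⟨i, by omega⟩ := Fin.ext hk
    obtain ⟨x₁, hx₁, h₁⟩ := H.exists_mem_limit (j + 1) (k j).castSucc
    obtain ⟨x₂, hx₂, h₂⟩ := H.exists_mem_limit (j + 1) (Fin.last _)
    have hnj : n j ≤ n (j + 1) := H.mono.monotone (Nat.le_succ j)
    have hkx : Agree (n m) (a j (k j)) x := by
      rw [hik]
      exact (H.coherent hj i i.2 _).trans hi.symm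
    have hU : ∀ y, Agree (n j) y (a j (k j)) → y ∈ U := fun y hy =>
      hVU (hm y (((hy.mono hmj).trans hkx).mono H.mono.le_apply))
    have h₁U := hU x₁ ((h₁.mono hnj).trans ((H.left j).1 (k j)))
    have h₂U := hU x₂ ((h₂.mono hnj).trans (H.right_last j))
    by_cases hne : x₁ = x
    · refine ⟨x₂, ⟨h₂U, hx₂⟩, fun h => ?_⟩
      have := H.sep (j + 1) _ _ (h₁.symm.trans ((hne.trans h.symm) ▸ h₂))
      exact (Fin.castSucc_lt_last (k j)).ne this
    · exact ⟨x₁, ⟨h₁U, hx₁⟩, hne⟩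

/-- Follow the indices approximating `x` and `y`. The witnesses of the approximating pairs
eventually cohere, and continuity of `f` sends their limit to `(x, y)`. -/
theorem limit_prod_subset (H : Fusion z r₀ a n k) {f : (ℕ → ℕ) → Reals × Reals}
    (hf : Continuous f) (hz : ∀ x y, f (z x y) = (x.1, y.1)) :
    limit a n ×ˢ limit a n ⊆ Set.range f := by
  rintro ⟨x, y⟩ ⟨hx, hy⟩
  choose I hI using hx
  choose J hJ using hy
  -- `Same` does not control the pair formed by the two halves of a split entry. That pair is met
  -- only where `x` and `y` part, hence never from stage `j₀` on.
  obtain ⟨j₀, hj₀⟩ : ∃ j₀, ∀ j ≥ j₀, I j = J j → x = y := by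
    by_cases hxy : x = y
    · exact ⟨0, fun _ _ _ => hxy⟩
    · obtain ⟨l, hl⟩ : ∃ l, ¬ Agree l x y := by
        by_contra! hc
        exact hxy (eq_of_forall_agree hc)
      refine ⟨l, fun j hj hIJ => (hl ?_).elim⟩
      exact ((hI j).trans (hIJ ▸ (hJ j).symm)).mono (hj.trans H.mono.le_apply)
  have hIJ : ∀ j, x = y → I j = J j := fun j hxy =>
    H.sep j _ _ ((hI j).symm.trans (hxy ▸ hJ j))
  let w : ℕ → ℕ → ℕ := fun j => z (a j (I j)) (a j (J j))
  have hstep : ∀ j ≥ j₀, ∀ l < n j, w (j + 1) l = w j l := by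
    intro j hj l hl
    have hnj : n j ≤ n (j + 1) := H.mono.monotone (Nat.le_succ j)
    have key : ∀ ι : Fin (r₀ + j + 1) → Fin (r₀ + j + 1 + 1), Same z (n j) (a (j + 1) ∘ ι) (a j) →
        ∀ u v, I (j + 1) = ι u → J (j + 1) = ι v → w (j + 1) l = w j l := by
      intro ι hι u v hu hv
      have h1 : u = I j := H.sep j _ _ ((hι.1 u).symm.trans
        ((hu ▸ (hI (j + 1)).symm.mono hnj).trans (hI j)))
      have h2 : v = J j := H.sep j _ _ ((hι.1 v).symm.trans
        ((hv ▸ (hJ (j + 1)).symm.mono hnj).trans (hJ j)))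
      have h3 := hι.2 u v l hl
      simp only [Function.comp_apply] at h3
      simp only [w]
      rw [hu, hv, ← h1, ← h2]
      exact h3
    have hr : Same z (n j) (a (j + 1) ∘ Function.update Fin.castSucc (k j) (Fin.last _)) (a j) := by
      rw [Function.comp_update]; exact H.right j
    have hk1 : ∀ u, I (j + 1) = u.castSucc → u = I j := fun u hu =>
      H.sep j _ _ (((H.left j).1 u).symm.trans ((hu ▸ (hI (j + 1)).symm.mono hnj).trans (hI j)))
    have hk2 : ∀ u, J (j + 1) = u.castSucc → u = J j := fun u hu =>
      H.sep j _ _ (((H.left j).1 u).symm.trans ((hu ▸ (hJ (j + 1)).symm.mono hnj).trans (hJ j)))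
    have hk3 : I (j + 1) = Fin.last _ → k j = I j := fun hu =>
      H.sep j _ _ ((H.right_last j).symm.trans ((hu ▸ (hI (j + 1)).symm.mono hnj).trans (hI j)))
    have hk4 : J (j + 1) = Fin.last _ → k j = J j := fun hu =>
      H.sep j _ _ ((H.right_last j).symm.trans ((hu ▸ (hJ (j + 1)).symm.mono hnj).trans (hJ j)))
    rcases Fin.eq_castSucc_or_eq_last (I (j + 1)) with ⟨u, hu⟩ | hu <;>
    rcases Fin.eq_castSucc_or_eq_last (J (j + 1)) with ⟨v, hv⟩ | hv
    · exact key Fin.castSucc (H.left j) u v hu hv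
    · have hne : u ≠ k j := by
        intro h
        have h1 := hIJ (j + 1) (hj₀ j hj (by rw [← hk1 u hu, h, hk4 hv]))
        rw [hu, hv] at h1
        exact (Fin.castSucc_lt_last u).ne h1
      exact key _ hr u (k j) (by rw [Function.update_of_ne hne, hu])
        (by rw [Function.update_self, hv])
    · have hne : v ≠ k j := by
        intro h
        have h1 := hIJ (j + 1) (hj₀ j hj (by rw [← hk2 v hv, h, hk3 hu]))
        rw [hu, hv] at h1
        exact (Fin.castSucc_lt_last v).ne h1.symm
      exact key _ hr (k j) v (by rw [Function.update_self, hu])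
        (by rw [Function.update_of_ne hne, hv])
    · exact key _ hr (k j) (k j) (by rw [Function.update_self, hu])
        (by rw [Function.update_self, hv])
  have hcoh : ∀ j ≥ j₀, ∀ j' ≥ j, ∀ l < n j, w j' l = w j l := by
    intro j hj j' hj' l hl
    induction j', hj' using Nat.le_induction with
    | base => rfl
    | succ j' hj' ih =>
      exact (hstep j' (hj.trans hj') l (hl.trans_le (H.mono.monotone hj'))).trans ih
  let v : ℕ → ℕ := fun l => w (j₀ + l + 1) l
  have hv : Filter.Tendsto w Filter.atTop (nhds v) := by
    rw [tendsto_pi_nhds]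
    intro l
    refine tendsto_nhds_of_eventually_eq ?_
    filter_upwards [Filter.eventually_ge_atTop (j₀ + l + 1)] with j hj
    exact hcoh (j₀ + l + 1) (by omega) j hj l ((by omega : l < j₀ + l + 1).trans_le H.mono.le_apply)
  have hlim : ∀ (x : Reals) (I : ∀ j, Fin (r₀ + j + 1)), (∀ j, Agree (n j) x (a j (I j))) →
      Filter.Tendsto (fun j => (a j (I j) : Reals)) Filter.atTop (nhds x) := by
    intro x I hI
    rw [tendsto_pi_nhds]
    intro l
    refine tendsto_nhds_of_eventually_eq ?_
    filter_upwards [Filter.eventually_gt_atTop l] with j hj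
    exact (hI j l (hj.trans_le H.mono.le_apply)).symm
  have h1 : Filter.Tendsto (fun j => f (w j)) Filter.atTop (nhds (x, y)) := by
    simp only [w, hz]
    exact (hlim x I hI).prodMk_nhds (hlim y J hJ)
  exact ⟨v, tendsto_nhds_unique ((hf.tendsto v).comp hv) h1⟩

end Fusion

end Fusion

/-! ### The splitting game and its ordinal stages. -/

section Derivative

variable {A : Set Reals} (z : A → A → ℕ → ℕ)

/-- The least level that separates the entries of a tuple. -/
noncomputable def level {r : ℕ} (a : Fin r → A) : ℕ :=
  sInf {n | ∀ i i', Agree n (a i) (a i') → i = i'}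

theorem level_spec {r : ℕ} {a : Fin r → A} (ha : Function.Injective a) (i i' : Fin r)
    (h : Agree (level a) (a i) (a i')) : i = i' := by
  have hne : {n | ∀ i i', Agree n (a i) (a i') → i = i'}.Nonempty := by
    classical
    obtain ⟨l, hl⟩ := Cond.exists_separating (Subtype.val : A → Reals) Subtype.val_injective
      (Finset.univ.image a)
    exact ⟨l, fun i i' h => ha (hl _ (Finset.mem_image_of_mem _ (Finset.mem_univ _)) _
      (Finset.mem_image_of_mem _ (Finset.mem_univ _)) h)⟩
  exact Nat.sInf_mem hne i i' h

/-- `b` arises from `a` by splitting the coordinate `k`, up to the level of `a`. -/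
def Splits {r : ℕ} (k : Fin (r + 1)) (a : Fin (r + 1) → A) (b : Fin (r + 2) → A) : Prop :=
  Function.Injective b ∧ Same z (level a) (b ∘ Fin.castSucc) a ∧
    Same z (level a) (Function.update (b ∘ Fin.castSucc) k (b (Fin.last _))) a

theorem Splits.level_lt {r : ℕ} {k : Fin (r + 1)} {a : Fin (r + 1) → A} {b : Fin (r + 2) → A}
    (h : Splits z k a b) : level a < level b := by
  by_contra! hc
  have h1 := h.2.1.1 k
  have h2 := h.2.2.1 k
  rw [Function.update_self] at h2
  exact (Fin.castSucc_lt_last k).ne (level_spec h.1 _ _ ((h1.trans h2.symm).mono hc))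

/-- The tuples for which the splitting game is lost by stage `γ`. -/
inductive Lost : Ordinal.{0} → ∀ r : ℕ, (Fin (r + 1) → A) → Prop
  | intro (γ : Ordinal.{0}) (r : ℕ) (a : Fin (r + 1) → A) (k : Fin (r + 1))
    (δ : (Fin (r + 2) → A) → Ordinal.{0}) (hδ : ∀ b, Splits z k a b → δ b < γ)
    (h : ∀ b, Splits z k a b → Lost (δ b) (r + 1) b) : Lost γ r a

/-- The finite information on a tuple. -/
abbrev TupleType : Type :=
  Σ (r n : ℕ), (Fin (r + 1) → Fin n → Bool) × (Fin (r + 1) → Fin (r + 1) → Fin n → ℕ)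

/-- The information on a tuple up to level `n`. -/
def typeAt {r : ℕ} (n : ℕ) (a : Fin (r + 1) → A) : TupleType :=
  ⟨r, n, fun i l => (a i : Reals) l, fun i j l => z (a i) (a j) l⟩

theorem same_of_typeAt_eq {r n n' : ℕ} {a b : Fin (r + 1) → A}
    (h : typeAt z n a = typeAt z n' b) : n = n' ∧ Same z n a b := by
  obtain ⟨-, h⟩ := Sigma.mk.inj_iff.1 h
  obtain ⟨rfl, h⟩ := Sigma.mk.inj_iff.1 (eq_of_heq h)
  obtain ⟨h1, h2⟩ := Prod.mk.injEq .. ▸ eq_of_heq h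
  exact ⟨rfl, fun i l hl => congrFun (congrFun h1 i) ⟨l, hl⟩,
    fun i j l hl => congrFun (congrFun (congrFun h2 i) j) ⟨l, hl⟩⟩

variable {z}

theorem Same.symm {n r : ℕ} {a b : Fin r → A} (h : Same z n a b) : Same z n b a :=
  ⟨fun i => (h.1 i).symm, fun i j l hl => (h.2 i j l hl).symm⟩

theorem Same.trans {n r : ℕ} {a b c : Fin r → A} (h : Same z n a b) (h' : Same z n b c) :
    Same z n a c :=
  ⟨fun i => (h.1 i).trans (h'.1 i), fun i j l hl => (h.2 i j l hl).trans (h'.2 i j l hl)⟩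

theorem Splits.congr {r : ℕ} {k : Fin (r + 1)} {a a' : Fin (r + 1) → A} {b : Fin (r + 2) → A}
    (h : typeAt z (level a) a = typeAt z (level a') a') (hs : Splits z k a b) :
    Splits z k a' b := by
  obtain ⟨h1, h2⟩ := same_of_typeAt_eq z h
  refine ⟨hs.1, ?_, ?_⟩
  · rw [← h1]; exact hs.2.1.trans h2
  · rw [← h1]; exact hs.2.2.trans h2

/-- Splittings refer to a tuple only up to its level, so the stage of loss depends on its type, of
which there are countably many. -/
theorem Lost.congr {r : ℕ} {a a' : Fin (r + 1) → A} {γ : Ordinal.{0}}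
    (h : typeAt z (level a) a = typeAt z (level a') a') (hl : Lost z γ r a) : Lost z γ r a' := by
  obtain ⟨_, _, _, k, δ, hδ, hL⟩ := hl
  exact ⟨γ, _, a', k, δ, fun b hb => hδ b (hb.congr h.symm), fun b hb => hL b (hb.congr h.symm)⟩

/-- If every splitting at `k` were lost, the supremum of the successors of their stages would be a
stage at which `a` is lost. -/
theorem exists_splits_of_not_lost {r : ℕ} {a : Fin (r + 1) → A} (ha : ∀ γ, ¬ Lost z γ r a)
    (k : Fin (r + 1)) : ∃ b, Splits z k a b ∧ ∀ γ, ¬ Lost z γ (r + 1) b := by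
  by_contra! hc
  have h : ∀ b, ∃ γ, Splits z k a b → Lost z γ (r + 1) b := fun b => by
    by_cases hb : Splits z k a b
    · obtain ⟨γ, hγ⟩ := hc b hb
      exact ⟨γ, fun _ => hγ⟩
    · exact ⟨0, fun h => (hb h).elim⟩
  choose δ hδ using h
  exact ha _ ⟨⨆ b, Order.succ (δ b), r, a, k, δ, fun b _ => (Order.lt_succ _).trans_le
    (Ordinal.le_iSup (fun b => Order.succ (δ b)) b), hδ⟩

theorem exists_fusion {r₀ : ℕ} {a₀ : Fin (r₀ + 1) → A} (hinj : Function.Injective a₀)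
    (ha₀ : ∀ γ, ¬ Lost z γ r₀ a₀) : ∃ a n k, Fusion z r₀ a n k := by
  let X : ℕ → Type := fun j =>
    {a : Fin (r₀ + j + 1) → A // Function.Injective a ∧ ∀ γ, ¬ Lost z γ (r₀ + j) a}
  -- Bookkeeping by the pairing function splits each index at arbitrarily late stages; at stage
  -- `Nat.pair i j` the index `i` is in range, so `Fin.ofNat` does not alter it.
  let k : ∀ j, Fin (r₀ + j + 1) := fun j => Fin.ofNat _ j.unpair.1
  have hstep : ∀ j (x : X j), ∃ y : X (j + 1), Splits z (k j) x.1 y.1 := fun j x => by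
    obtain ⟨b, hb, hb'⟩ := exists_splits_of_not_lost x.2.2 (k j)
    exact ⟨⟨b, hb.1, hb'⟩, hb⟩
  choose g hg using hstep
  let s : ∀ j, X j := fun j => Nat.rec (motive := X) ⟨a₀, hinj, ha₀⟩ (fun j x => g j x) j
  have hs : ∀ j, Splits z (k j) (s j).1 (s (j + 1)).1 := fun j => hg j (s j)
  refine ⟨fun j => (s j).1, fun j => level (s j).1, k, fun j i i' h => level_spec (s j).2.1 i i' h,
    strictMono_nat_of_lt_succ fun j => (hs j).level_lt, fun j => (hs j).2.1, fun j => (hs j).2.2,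
    fun i j => ⟨Nat.pair i j, Nat.right_le_pair i j, ?_⟩⟩
  have : i < r₀ + Nat.pair i j + 1 := by
    have := Nat.left_le_pair i j
    omega
  simp [k, Nat.mod_eq_of_lt this]

/-- Colour a tuple by its type at its level, with the least stage of loss as ordinal. A twin of
equal type makes `Fin.snoc a b` a splitting of `a`, which is lost earlier. -/
theorem thin_of_lost (h : ∀ (r : ℕ) (a : Fin (r + 1) → A), Function.Injective a →
    ∃ γ, Lost z γ r a) : Thin A := by
  let D : ∀ r : ℕ, (Fin (r + 1) → A) → TupleType := fun r a => typeAt z (level a) a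
  let β : TupleType → Ordinal.{0} := fun d => sInf {γ | ∃ r a, D r a = d ∧ Lost z γ r a}
  have hβle : ∀ r a γ, Lost z γ r a → β (D r a) ≤ γ := fun r a γ hL =>
    csInf_le' (s := {γ | ∃ r' a', D r' a' = D r a ∧ Lost z γ r' a'}) ⟨r, a, rfl, hL⟩
  have hβ : ∀ r a, Function.Injective a → Lost z (β (D r a)) r a := fun r a ha => by
    have hne : {γ | ∃ r' a', D r' a' = D r a ∧ Lost z γ r' a'}.Nonempty := by
      obtain ⟨γ, hγ⟩ := h r a ha
      exact ⟨γ, r, a, rfl, hγ⟩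
    obtain ⟨r', a', hD, hL⟩ := csInf_mem hne
    obtain rfl : r' = r := (Sigma.mk.inj_iff.1 hD).1
    exact hL.congr hD
  have hk : ∀ (r : ℕ) (d : TupleType), ∃ k : Fin (r + 1), ∀ a, Function.Injective a → D r a = d →
      ∀ b, Splits z k a b → β (D (r + 1) b) < β d := by
    intro r d
    by_cases hd : ∃ a, Function.Injective a ∧ D r a = d
    · obtain ⟨a, ha, rfl⟩ := hd
      obtain ⟨_, _, _, k, δ, hδ, hL⟩ := hβ r a ha
      refine ⟨k, fun a' _ hD b hb => ?_⟩
      have hb' := hb.congr hD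
      exact (hβle _ _ _ (hL b hb')).trans_lt (hδ b hb')
    · exact ⟨0, fun a ha hD => (hd ⟨a, ha, hD⟩).elim⟩
  choose k hk using hk
  have : Nonempty TupleType := ⟨⟨0, 0, fun _ _ => false, fun _ _ _ => 0⟩⟩
  refine ⟨Order.succ (⨆ d, β d), ThinBelow.of_countable D k β
    (fun d => Order.lt_succ_iff.2 (Ordinal.le_iSup β d)) fun r a b ha hb hD => ?_⟩
  refine hk r (D r a) a ha rfl _ ⟨Fin.snoc_injective_iff.2 ⟨ha, hb⟩, ?_, ?_⟩
  · rw [Fin.snoc_comp_castSucc]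
    exact ⟨fun _ => Agree.rfl, fun _ _ _ _ => rfl⟩
  · rw [Fin.snoc_comp_castSucc, Fin.snoc_last]
    exact (same_of_typeAt_eq z hD.symm).2.symm

end Derivative

/-! ### Borel sets without perfect squares, and the theorem. -/

instance : PolishSpace Reals := by
  let _ := TopologicalSpace.metrizableSpaceMetric Reals
  infer_instance

/-- The size of a square in a Borel set without perfect squares is thin. -/
theorem thin_of_borel {B : Set (Reals × Reals)} (hB : IsBorel B)
    (hP : ¬ ContainsPerfectSquare B) {A : Set Reals} (hA : A ×ˢ A ⊆ B) : Thin A := by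
  rcases A.eq_empty_or_nonempty with rfl | ⟨x, hx⟩
  · exact ⟨1, ThinBelow.of_countable_type⟩
  let _ : MeasurableSpace (Reals × Reals) := borel _
  have : BorelSpace (Reals × Reals) := ⟨rfl⟩
  have hB' : MeasureTheory.AnalyticSet B := MeasurableSet.analyticSet hB
  rw [MeasureTheory.AnalyticSet] at hB'
  obtain rfl | ⟨f, hf, rfl⟩ := hB'
  · exact (hA (Set.mk_mem_prod hx hx)).elim
  -- `z x y` is a point of Baire space that `f` maps to `(x, y)`.
  choose z hz using fun x y : A => hA (Set.mk_mem_prod x.2 y.2)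
  refine thin_of_lost (z := z) fun r a ha => ?_
  by_contra! hc
  obtain ⟨a, n, k, H⟩ := exists_fusion ha hc
  obtain ⟨y, hy, -⟩ := H.exists_mem_limit 0 0
  exact hP ⟨_, H.perfect_limit, ⟨y, hy⟩, H.limit_prod_subset hf hz⟩

/-- A set that contains a perfect square contains a square of the size of the continuum. -/
theorem ContainsPerfectSquare.containsSquare {B : Set (Reals × Reals)}
    (h : ContainsPerfectSquare B) : ContainsSquare B 𝔠 := by
  obtain ⟨C, hC, hne, hCB⟩ := h
  let _ := TopologicalSpace.metrizableSpaceMetric Reals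
  obtain ⟨f, hf, -, hi⟩ := hC.exists_nat_bool_injection hne
  refine ⟨C, le_antisymm ((Cardinal.mk_set_le C).trans (by simp)) ?_, hCB⟩
  rw [← Cardinal.mk_range_eq f hi |>.trans (by simp : #(ℕ → Bool) = 𝔠)]
  exact Cardinal.mk_le_mk_of_subset hf

end BorelSquares

theorem theorem1p12 (hMA : BorelSquares.MartinsAxiom) :
    (∀ μ : Cardinal.{0}, BorelSquares.lambda (ω_ 1) ℵ₀ ≤ 𝔠 ∨ μ < 𝔠 →
      ((∃ B : Set (BorelSquares.Reals × BorelSquares.Reals),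
          BorelSquares.IsBorel B ∧
          BorelSquares.ContainsSquare B μ ∧ ¬ BorelSquares.ContainsPerfectSquare B) ↔
        μ < BorelSquares.lambda (ω_ 1) ℵ₀)) ∧
    ((∀ α : Ordinal.{0}, α < ω_ 1 → ℵ_ α ≤ 𝔠) →
      ∀ α : Ordinal.{0}, α < ω_ 1 → ¬ BorelSquares.Otimes (ℵ_ α)) ∧
    (∀ μ : Cardinal.{0}, IsLeast {ν : Cardinal.{0} | BorelSquares.Otimes ν} μ → μ < 𝔠 →
      μ.ord.cof = ℵ_ 1) := by
  open BorelSquares in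
  have hthin : ∀ {μ : Cardinal.{0}} {B}, IsBorel B → ContainsSquare B μ →
      ¬ ContainsPerfectSquare B → ∀ M : Type, #M = μ → Thin M := by
    rintro μ B hB ⟨A, hA, hAB⟩ hP M hM
    exact (thin_of_borel hB hP hAB).of_mk_le (hM.trans hA.symm).le
  refine ⟨fun μ hμ => ⟨?_, fun h => ?_⟩, fun hc α hα hO => ?_, fun μ hμ hlt => ?_⟩
  · rintro ⟨B, hB, hsq, hP⟩
    rw [← Cardinal.mk_out μ]
    exact (mk_lt_lambda_iff _).2 (hthin hB hsq hP _ (Cardinal.mk_out μ))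
  -- Either hypothesis puts `μ` strictly below the continuum, as the forcing requires.
  · have hlt : μ < 𝔠 := hμ.elim h.trans_le id
    rw [← Cardinal.mk_out μ] at h hlt ⊢
    exact exists_borel_of_thin hMA ((mk_lt_lambda_iff _).1 h) hlt
  -- Strictness comes from the next aleph, which is still at most `𝔠`.
  · have hlt : #(ℵ_ α).out < 𝔠 := by
      rw [Cardinal.mk_out]
      exact (Cardinal.aleph_lt_aleph.2 (Order.lt_add_one_iff.2 le_rfl)).trans_le
        (hc (α + 1) ((Cardinal.isSuccLimit_omega 1).add_one_lt hα))
    obtain ⟨B, hB, hsq, hP⟩ := exists_borel_of_thin hMA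
      (thin_of_mk_le_aleph hα (ℵ_ α).out (Cardinal.mk_out _).le) hlt
    rw [Cardinal.mk_out] at hsq
    exact hP (hO B hB hsq).2
  · rw [← Cardinal.mk_out μ] at hlt ⊢
    -- The least `μ` with `Otimes μ` is the least non-thin cardinal: a thin one below `𝔠` violates
    -- `Otimes` by forcing, and a non-thin one satisfies it because every Borel set with such a
    -- square has a perfect square.
    refine cof_eq_aleph_one_of_least (fun hT => ?_) fun N hN => ?_
    · obtain ⟨B, hB, hsq, hP⟩ := exists_borel_of_thin hMA hT hlt
      rw [Cardinal.mk_out] at hsq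
      exact hP (hμ.1 B hB hsq).2
    · by_contra hc
      rw [Cardinal.mk_out] at hN
      refine (hμ.2 fun B hB hsq => ?_).not_gt hN
      have hP : ContainsPerfectSquare B := by
        by_contra hP
        exact hc (hthin hB hsq hP N rfl)
      exact ⟨hP.containsSquare, hP⟩
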